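/- Lemma 3.3. Let $\sigma:\mathbb R^2\to\mathbb R$ be a measurable function with $c^{-1}\le\sigma\le c$ for some constant $c>1$, and let $D\subset\mathbb R^2$ be a bounded domain (non-empty, open, connected) whose complement $\mathbb R^2\setminus D$ is connected and such that $\operatorname{supp}(\sigma-1)\subset D$. Suppose that $\sigma$ is radially symmetric, that is, $\sigma(x)$ depends only on $|x|$. Let $(r,\theta)$ be polar coordinates in the plane and let $m\in\mathbb N$. Then the problem $$ \nabla\cdot(\sigma\nabla u_m)=0\ \text{ in }\mathbb R^2,\qquad u_m-r^m\cos m\theta\to 0\ \text{ as } r\to\infty, $$ has exactly one weak solution $u_m\in H^1_{\mathrm{loc}}(\mathbb R^2)$ (up to equality almost everywhere), where the limit is uniform in $\theta$ and, like every statement on the values of $u_m$, is understood up to null sets. Moreover, there is a constant $b_m\in\mathbb R$ such that $$ u_m=\Bigl(r^m+\frac{b_m}{r^m}\Bigr)\cos m\theta\qquad\text{almost everywhere in }\mathbb R^2\setminus D . $$ -/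

import Mathlib

open MeasureTheory Filter Topology
open scoped ContDiff Gradient

/-- The Euclidean plane. -/
abbrev Plane : Type := EuclideanSpace ℝ (Fin 2)

/-- The polar angle of a point of the plane. -/
noncomputable def polarAngle (x : Plane) : ℝ := Complex.arg ⟨x 0, x 1⟩

/-- Membership in `L²_loc(ℝ²)`. -/
def IsLocL2 {F : Type*} [NormedAddCommGroup F] (f : Plane → F) : Prop :=
  ∀ K : Set Plane, IsCompact K → MemLp f 2 (volume.restrict K)

/-- `G` is the weak (distributional) gradient of `u` on the plane; to be used for `u`, `G` in
`L²_loc`, where all the integrals converge. -/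
def IsWeakGradient (u : Plane → ℝ) (G : Plane → Plane) : Prop :=
  ∀ φ : Plane → ℝ, ContDiff ℝ ∞ φ → HasCompactSupport φ →
    ∀ i : Fin 2, ∫ x, u x * (∇ φ x) i = - ∫ x, G x i * φ x

/-- `u` is a weak solution, in `H¹_loc(ℝ²)`, of `∇ · (σ ∇ u) = 0` in the whole plane. -/
def IsConductivitySolution (σ : Plane → ℝ) (u : Plane → ℝ) : Prop :=
  IsLocL2 u ∧ ∃ G : Plane → Plane, IsLocL2 G ∧ IsWeakGradient u G ∧
    ∀ φ : Plane → ℝ, ContDiff ℝ ∞ φ → HasCompactSupport φ →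
      ∫ x, σ x * inner ℝ (G x) (∇ φ x) = 0

/-- `f(x) → 0` as `|x| → ∞`, for a function `f` that is only determined almost everywhere:
for every `ε > 0` there is `R` with `|f(x)| < ε` for almost every `x` with `|x| > R`. -/
def VanishesAtInfinity (f : Plane → ℝ) : Prop :=
  ∀ ε : ℝ, 0 < ε → ∃ R : ℝ, ∀ᵐ x : Plane, R < ‖x‖ → |f x| < ε

/-- `u` solves `∇ · (σ ∇ u) = 0` in `ℝ²` with `u - r ^ m cos (m θ) → 0` at infinity. -/
def IsModeSolution (σ : Plane → ℝ) (m : ℕ) (u : Plane → ℝ) : Prop :=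
  IsConductivitySolution σ u ∧
    VanishesAtInfinity (fun x => u x - ‖x‖ ^ m * Real.cos (m * polarAngle x))

/-- `σ` is radially symmetric (about the origin). -/
def IsRadiallySymmetric (σ : Plane → ℝ) : Prop :=
  ∀ x y : Plane, ‖x‖ = ‖y‖ → σ x = σ y

/-! ### Mollification in the plane -/

/-! Uniqueness is a Liouville theorem, `IsConductivitySolution.ae_eq_zero`, applied to the
difference `w` of two solutions. Caccioppoli's inequality with a cutoff at scale `R` bounds the
energy of `w` on a fixed disc by a constant times the square of a bound for `|w|` far out: in
dimension two the factor `R⁻²` from the squared gradient of the cutoff is balanced by an area of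
order `R²`. As `w` vanishes at infinity, its gradient is zero, so `w` is constant and then zero.

Existence is by separation of variables. For `f(r) cos (m θ)` and the flux `p = r s f'` the equation
reads `f' = p / (s r)`, `p' = m² s f / r`, with `s` merely measurable and a singular point at `r =
0`. For `m > 0` the ratio `q = p / (m f)` satisfies the Riccati equation `r q' = m s - m q² / s`,
for which `[c⁻¹, c]` is invariant. A contraction argument gives a solution on the whole half line
(`exists_riccati_solution`). Then `f = exp ∫ m q / (s r)` is positive and `O(r ^ δ)` at the origin
with `δ > 0`, which makes the energy finite there. Where `s = 1`, the functions `r ^ (-m) (m f + p)`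
and `r ^ m (m f - p)` are constant, so `f` is a combination of `r ^ m` and `r ^ (-m)`; the first
coefficient is positive, so `f` can be normalised (`exists_isRadialProfile`). A divergence theorem
in polar coordinates, `integral_polar_divergence`, converts the radial equations into the weak
formulation across the origin.

The formula holds outside `D` because the support of `σ - 1` is rotation invariant: its outermost
circle lies in `D`, and the unbounded connected complement of `D` cannot cross it
(`IsRadiallySymmetric.exists_radius`). -/

/-- A sequence of bump functions at the origin whose supports shrink to a point. -/
noncomputable def shrinkingBump (n : ℕ) : ContDiffBump (0 : Plane) where
  rIn := 1 / (2 * (n + 1))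
  rOut := 1 / (n + 1)
  rIn_pos := by positivity
  rIn_lt_rOut := by
    apply one_div_lt_one_div_of_lt (by positivity)
    have : (0 : ℝ) < n + 1 := by positivity
    linarith

/-- The standard mollifiers. -/
noncomputable def mollifier (n : ℕ) : Plane → ℝ := (shrinkingBump n).normed volume

/-- The convolution of a function with a standard mollifier. -/
noncomputable def mollify (n : ℕ) (f : Plane → ℝ) : Plane → ℝ :=
  fun x => ∫ y, mollifier n y * f (x - y)

lemma tendsto_shrinkingBump_rOut :
    Tendsto (fun n => (shrinkingBump n).rOut) atTop (𝓝 0) :=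
  tendsto_one_div_add_atTop_nhds_zero_nat

lemma shrinkingBump_rOut_le_one (n : ℕ) : (shrinkingBump n).rOut ≤ 1 := by
  change 1 / ((n : ℝ) + 1) ≤ 1
  rw [div_le_one (by positivity)]
  linarith [n.cast_nonneg (α := ℝ)]

lemma mollifier_nonneg (n : ℕ) (x : Plane) : 0 ≤ mollifier n x :=
  (shrinkingBump n).nonneg_normed x

lemma integrable_mollifier (n : ℕ) : Integrable (mollifier n) :=
  (shrinkingBump n).integrable_normed

lemma integral_mollifier (n : ℕ) : ∫ x, mollifier n x = 1 :=
  (shrinkingBump n).integral_normed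

lemma contDiff_mollifier (n : ℕ) : ContDiff ℝ ∞ (mollifier n) :=
  (shrinkingBump n).contDiff_normed (n := ⊤)

lemma hasCompactSupport_mollifier (n : ℕ) : HasCompactSupport (mollifier n) :=
  (shrinkingBump n).hasCompactSupport_normed

lemma mollifier_eq_zero {n : ℕ} {x : Plane} (hx : 1 < ‖x‖) : mollifier n x = 0 := by
  have : x ∉ Function.support (mollifier n) := by
    unfold mollifier
    rw [(shrinkingBump n).support_normed_eq]
    simpa using (shrinkingBump_rOut_le_one n).trans hx.le
  simpa using this

lemma mollify_eq_convolution (n : ℕ) (f : Plane → ℝ) :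
    mollify n f = convolution (mollifier n) f (ContinuousLinearMap.lsmul ℝ ℝ) volume := rfl

lemma mollify_eq_integral_sub (n : ℕ) (f : Plane → ℝ) (x : Plane) :
    mollify n f x = ∫ y, mollifier n (x - y) * f y := by
  rw [mollify, ← integral_sub_left_eq_self _ volume x]
  simp

lemma contDiff_mollify (n : ℕ) {f : Plane → ℝ} (hf : LocallyIntegrable f) :
    ContDiff ℝ ∞ (mollify n f) := by
  rw [mollify_eq_convolution]
  exact (hasCompactSupport_mollifier n).contDiff_convolution_left _ (contDiff_mollifier n) hf

lemma ae_tendsto_mollify {f : Plane → ℝ} (hf : LocallyIntegrable f) :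
    ∀ᵐ x, Tendsto (fun n => mollify n f x) atTop (𝓝 (f x)) := by
  refine ContDiffBump.ae_convolution_tendsto_right_of_locallyIntegrable (K := 2)
    tendsto_shrinkingBump_rOut (Eventually.of_forall fun n => ?_) hf
  change 1 / ((n : ℝ) + 1) ≤ 2 * (1 / (2 * (n + 1)))
  have : (0 : ℝ) < n + 1 := by positivity
  field_simp
  rfl

/-- The correlation of two square-integrable functions is continuous. -/
lemma continuous_integral_mul_sub {F f : Plane → ℝ} (hF : MemLp F 2) (hf : MemLp f 2) :
    Continuous fun y => ∫ x, F x * f (x - y) := by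
  have hmp : ∀ y : Plane, MeasurePreserving (fun x : Plane => x - y) volume volume :=
    fun y => measurePreserving_sub_right volume y
  let g : Plane → C(Plane, Plane) := fun y => ⟨fun x => x - y, by fun_prop⟩
  have hg : Continuous g := by
    have : Continuous (fun p : Plane × Plane => p.2 - p.1) := by fun_prop
    exact (ContinuousMap.curry ⟨_, this⟩).continuous
  have hL : Continuous fun y => Lp.compMeasurePreserving (g y) (hmp y) (hf.toLp f) :=
    continuous_const.compMeasurePreservingLp hg hmp (by simp)
  have hI : Continuous fun y =>
      inner ℝ (hF.toLp F) (Lp.compMeasurePreserving (g y) (hmp y) (hf.toLp f)) :=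
    continuous_const.inner hL
  refine hI.congr fun y => ?_
  rw [L2.inner_def]
  refine integral_congr_ae ?_
  have h1 := Lp.coeFn_compMeasurePreserving (hf.toLp f) (hmp y)
  have h2 : (hf.toLp f : Plane → ℝ) ∘ (g y) =ᵐ[volume] f ∘ (g y) :=
    (hmp y).quasiMeasurePreserving.ae_eq_comp hf.coeFn_toLp
  filter_upwards [h1, h2, hF.coeFn_toLp] with x hx1 hx2 hx3
  rw [hx3]
  erw [hx1, hx2]
  simp [g, mul_comm]

/-- This is the hypothesis of Fubini's theorem for the weak convergence below. It follows from `|a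
b| ≤ a² + b²`, each square being integrable against the mollifier. -/
lemma integrable_mul_mollifier_mul {F f : Plane → ℝ} (hF : MemLp F 2) (hf : MemLp f 2) (n : ℕ) :
    Integrable (fun p : Plane × Plane => F p.1 * (mollifier n p.2 * f (p.1 - p.2)))
      (volume.prod volume) := by
  have h1 : Integrable (fun p : Plane × Plane => F p.1 ^ 2 * mollifier n p.2)
      (volume.prod volume) := hF.integrable_sq.mul_prod (integrable_mollifier n)
  have h2 : Integrable (fun p : Plane × Plane => mollifier n p.2 * f (p.1 - p.2) ^ 2)
      (volume.prod volume) :=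
    (integrable_mollifier n).convolution_integrand (ContinuousLinearMap.lsmul ℝ ℝ)
      hf.integrable_sq
  have hmeas : AEStronglyMeasurable
      (fun p : Plane × Plane => F p.1 * (mollifier n p.2 * f (p.1 - p.2)))
      (volume.prod volume) :=
    hF.aestronglyMeasurable.comp_fst.mul
      ((integrable_mollifier n).aestronglyMeasurable.convolution_integrand
        (ContinuousLinearMap.lsmul ℝ ℝ) hf.aestronglyMeasurable)
  refine (h1.add h2).mono' hmeas (Eventually.of_forall fun p => ?_)
  have h0 := mollifier_nonneg n p.2
  have hab : |F p.1 * f (p.1 - p.2)| ≤ F p.1 ^ 2 + f (p.1 - p.2) ^ 2 := by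
    rw [abs_le]
    constructor <;> nlinarith [sq_nonneg (F p.1 + f (p.1 - p.2)), sq_nonneg (F p.1 - f (p.1 - p.2)),
      sq_nonneg (F p.1), sq_nonneg (f (p.1 - p.2))]
  calc ‖F p.1 * (mollifier n p.2 * f (p.1 - p.2))‖
      = mollifier n p.2 * |F p.1 * f (p.1 - p.2)| := by
        rw [Real.norm_eq_abs, show F p.1 * (mollifier n p.2 * f (p.1 - p.2)) =
          mollifier n p.2 * (F p.1 * f (p.1 - p.2)) by ring, abs_mul, abs_of_nonneg h0]
    _ ≤ mollifier n p.2 * (F p.1 ^ 2 + f (p.1 - p.2) ^ 2) := by gcongr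
    _ = _ := by simp only [Pi.add_apply]; ring

lemma integrable_mul_mollify {F f : Plane → ℝ} (hF : MemLp F 2) (hf : MemLp f 2) (n : ℕ) :
    Integrable fun x => F x * mollify n f x := by
  have := (integrable_mul_mollifier_mul hF hf n).integral_prod_left
  simpa only [integral_const_mul, mollify] using this

/-- Mollifications of a square-integrable function converge weakly in `L²`. -/
lemma tendsto_integral_mul_mollify {F f : Plane → ℝ} (hF : MemLp F 2) (hf : MemLp f 2) :
    Tendsto (fun n => ∫ x, F x * mollify n f x) atTop (𝓝 (∫ x, F x * f x)) := by
  have hcont := continuous_integral_mul_sub hF hf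
  -- By Fubini, pairing `F` with a mollification of `f` amounts to mollifying their correlation at
  -- `0`, where it is continuous.
  have hlim := ContDiffBump.convolution_tendsto_right_of_continuous (μ := volume)
    (g := fun y => ∫ x, F x * f (x + y)) tendsto_shrinkingBump_rOut
    (by simpa [Function.comp_def] using hcont.comp continuous_neg) 0
  simp only [add_zero] at hlim
  refine hlim.congr fun n => ?_
  calc (∫ y, mollifier n y • ∫ x, F x * f (x + (0 - y)))
      = ∫ y, ∫ x, F x * (mollifier n y * f (x - y)) := by
        refine integral_congr_ae (Eventually.of_forall fun y => ?_)
        simp only [smul_eq_mul]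
        rw [← integral_const_mul]
        refine integral_congr_ae (Eventually.of_forall fun x => ?_)
        simp only [zero_sub, ← sub_eq_add_neg]
        ring
    _ = ∫ x, ∫ y, F x * (mollifier n y * f (x - y)) :=
        (integral_integral_swap (integrable_mul_mollifier_mul hF hf n)).symm
    _ = _ := by simp only [integral_const_mul, mollify]

/-! ### Local square-integrability and weak gradients -/

lemma IsLocL2.aestronglyMeasurable {F : Type*} [NormedAddCommGroup F] {f : Plane → F}
    (hf : IsLocL2 f) : AEStronglyMeasurable f volume := by
  have h := aestronglyMeasurable_iUnion_iff (μ := volume) (f := f)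
    (s := fun n : ℕ => Metric.closedBall (0 : Plane) n)
  rw [Metric.iUnion_closedBall_nat, Measure.restrict_univ] at h
  exact h.2 fun n => (hf _ (isCompact_closedBall _ _)).aestronglyMeasurable

lemma IsLocL2.locallyIntegrable {F : Type*} [NormedAddCommGroup F] {f : Plane → F}
    (hf : IsLocL2 f) : LocallyIntegrable f := by
  refine locallyIntegrable_iff.2 fun K hK => ?_
  have : IsFiniteMeasure (volume.restrict K) := ⟨by simpa using hK.measure_lt_top⟩
  exact (hf K hK).integrable (by norm_num)

lemma IsLocL2.sub {F : Type*} [NormedAddCommGroup F] {f g : Plane → F}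
    (hf : IsLocL2 f) (hg : IsLocL2 g) : IsLocL2 (fun x => f x - g x) :=
  fun K hK => (hf K hK).sub (hg K hK)

lemma IsLocL2.apply {G : Plane → Plane} (hG : IsLocL2 G) (i : Fin 2) :
    IsLocL2 (fun x => G x i) := fun K hK => by
  refine (hG K hK).mono ?_ (Eventually.of_forall fun x => PiLp.norm_apply_le (G x) i)
  exact (EuclideanSpace.proj (𝕜 := ℝ) i).continuous.comp_aestronglyMeasurable
    (hG K hK).aestronglyMeasurable

lemma IsLocL2.memLp_indicator {f : Plane → ℝ} (hf : IsLocL2 f) (R : ℝ) :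
    MemLp ((Metric.closedBall (0 : Plane) R).indicator f) 2 :=
  (memLp_indicator_iff_restrict Metric.isClosed_closedBall.measurableSet).2
    (hf _ (isCompact_closedBall _ _))

/-- A bounded compactly supported multiple of an `L²_loc` function is in `L²`. -/
lemma IsLocL2.memLp_mul {f h : Plane → ℝ} (hf : IsLocL2 f) (hh : AEStronglyMeasurable h volume)
    {C R : ℝ} (hC : ∀ x, |h x| ≤ C) (hR : ∀ x, R < ‖x‖ → h x = 0) :
    MemLp (fun x => h x * f x) 2 := by
  refine (hf.memLp_indicator R).of_le_mul (c := C) (hh.mul hf.aestronglyMeasurable)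
    (Eventually.of_forall fun x => ?_)
  by_cases hx : ‖x‖ ≤ R
  · rw [Set.indicator_of_mem (by simpa using hx), norm_mul]
    exact mul_le_mul_of_nonneg_right (hC x) (norm_nonneg _)
  · rw [hR x (not_le.1 hx)]
    simpa using mul_nonneg ((abs_nonneg (h x)).trans (hC x))
      (norm_nonneg ((Metric.closedBall (0 : Plane) R).indicator f x))

/-- Mollifiers are supported in the unit ball, so values of `f` beyond radius `R + 1` play no role.
This reduces `L²_loc` to `L²`. -/
lemma mollify_indicator_eq (n : ℕ) (f : Plane → ℝ) {R : ℝ} {x : Plane} (hx : ‖x‖ ≤ R) :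
    mollify n ((Metric.closedBall (0 : Plane) (R + 1)).indicator f) x = mollify n f x := by
  refine integral_congr_ae (Eventually.of_forall fun y => ?_)
  by_cases hy : 1 < ‖y‖
  · simp [mollifier_eq_zero hy]
  · simp only
    rw [Set.indicator_of_mem]
    have := norm_sub_le x y
    simp only [Metric.mem_closedBall, dist_zero_right]
    linarith

/-- Mollifications of an `L²_loc` function converge weakly against compactly supported `L²`
functions. -/
lemma IsLocL2.tendsto_integral_mul_mollify {F f : Plane → ℝ} (hf : IsLocL2 f) (hF : MemLp F 2)
    {R : ℝ} (hR : ∀ x, R < ‖x‖ → F x = 0) :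
    (∀ n, Integrable fun x => F x * mollify n f x) ∧
      Tendsto (fun n => ∫ x, F x * mollify n f x) atTop (𝓝 (∫ x, F x * f x)) := by
  have h1 : ∀ n, (fun x => F x * mollify n ((Metric.closedBall (0 : Plane) (R + 1)).indicator f) x)
      = fun x => F x * mollify n f x := fun n => by
    ext x
    by_cases hx : ‖x‖ ≤ R
    · rw [mollify_indicator_eq n f hx]
    · simp [hR x (not_le.1 hx)]
  have h2 : (fun x => F x * (Metric.closedBall (0 : Plane) (R + 1)).indicator f x)
      = fun x => F x * f x := by
    ext x
    by_cases hx : ‖x‖ ≤ R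
    · rw [Set.indicator_of_mem (by simp; linarith)]
    · simp [hR x (not_le.1 hx)]
  have hi := hf.memLp_indicator (R + 1)
  refine ⟨fun n => h1 n ▸ integrable_mul_mollify hF hi n, ?_⟩
  have := _root_.tendsto_integral_mul_mollify hF hi
  simpa only [h1, h2] using this

lemma gradient_apply (φ : Plane → ℝ) (x : Plane) (i : Fin 2) :
    (∇ φ x) i = fderiv ℝ φ x (EuclideanSpace.single i 1) := by
  rw [← inner_gradient_left, EuclideanSpace.inner_single_right]
  simp

lemma contDiff_gradient_apply {φ : Plane → ℝ} (hφ : ContDiff ℝ ∞ φ) (i : Fin 2) :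
    ContDiff ℝ ∞ (fun x => (∇ φ x) i) := by
  simp only [gradient_apply]
  exact (hφ.fderiv_right (m := ∞) (by simp)).clm_apply contDiff_const

lemma hasCompactSupport_gradient_apply {φ : Plane → ℝ} (hφ : HasCompactSupport φ) (i : Fin 2) :
    HasCompactSupport (fun x => (∇ φ x) i) := by
  simp only [gradient_apply]
  exact (hφ.fderiv (𝕜 := ℝ)).comp_left (g := fun L => L (EuclideanSpace.single i 1)) (by simp)

lemma exists_radius_of_hasCompactSupport {φ : Plane → ℝ} (hφ : HasCompactSupport φ) :
    ∃ R : ℝ, ∀ x, R < ‖x‖ → φ x = 0 := by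
  obtain ⟨R, hR⟩ := hφ.isCompact.isBounded.subset_closedBall (0 : Plane)
  refine ⟨R, fun x hx => image_eq_zero_of_notMem_tsupport fun h => ?_⟩
  have := hR h
  simp at this
  linarith

lemma exists_bound_of_hasCompactSupport {φ : Plane → ℝ} (hφ : HasCompactSupport φ)
    (hc : Continuous φ) : ∃ C : ℝ, ∀ x, |φ x| ≤ C :=
  hφ.exists_bound_of_continuous hc

/-- Mollification commutes with the weak gradient. -/
lemma IsWeakGradient.gradient_mollify {u : Plane → ℝ} {G : Plane → Plane}
    (h : IsWeakGradient u G) (hu : LocallyIntegrable u) (n : ℕ) (x : Plane) (i : Fin 2) :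
    (∇ (mollify n u) x) i = mollify n (fun y => G y i) x := by
  have hd := (hasCompactSupport_mollifier n).hasFDerivAt_convolution_left
    (ContinuousLinearMap.lsmul ℝ ℝ) ((contDiff_mollifier n).of_le (by simp)) hu x
  rw [gradient_apply, mollify_eq_convolution, hd.fderiv]
  have hcs : HasCompactSupport (fun y => mollifier n (x - y)) :=
    (hasCompactSupport_mollifier n).comp_homeomorph (Homeomorph.subLeft x)
  have hex : ConvolutionExistsAt (fderiv ℝ (mollifier n)) u x
      ((ContinuousLinearMap.lsmul ℝ ℝ).precompL Plane) volume :=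
    ((hasCompactSupport_mollifier n).fderiv ℝ).convolutionExists_left _
      ((contDiff_mollifier n).continuous_fderiv (by simp)) hu x
  -- The test function is the reflected mollifier centred at `x`; the sign from the reflection
  -- cancels the sign in the weak derivative.
  have key := h (fun y => mollifier n (x - y))
    ((contDiff_mollifier n).comp (contDiff_const.sub contDiff_id)) hcs i
  rw [mollify_eq_integral_sub, convolution_eq_swap]
  refine (ContinuousLinearMap.integral_apply hex.integrable_swap _).trans ?_
  have h3 : ∀ y, (∇ (fun y => mollifier n (x - y)) y) i =
      - fderiv ℝ (mollifier n) (x - y) (EuclideanSpace.single i 1) := fun y => by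
    have hc : HasFDerivAt (fun y => mollifier n (x - y)) _ y :=
      (((contDiff_mollifier n).differentiable (by simp)) (x - y)).hasFDerivAt.comp y
        ((hasFDerivAt_const x y).sub (hasFDerivAt_id y))
    rw [gradient_apply, hc.fderiv]
    simp
  simp only [h3, mul_neg, integral_neg, neg_inj] at key
  simp only [ContinuousLinearMap.precompL_apply, ContinuousLinearMap.lsmul_apply, smul_eq_mul]
  rw [show (∫ y, mollifier n (x - y) * G y i) = ∫ y, G y i * mollifier n (x - y) by
    simp only [mul_comm], ← key]
  simp only [mul_comm]

/-! ### A Liouville theorem for conductivity equations -/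

lemma inner_plane (a b : Plane) : inner ℝ a b = a 0 * b 0 + a 1 * b 1 := by
  simp [PiLp.inner_apply, Fin.sum_univ_two, mul_comm]

lemma IsLocL2.integrable_mul {f ψ : Plane → ℝ} (hf : IsLocL2 f) (hψ : Continuous ψ)
    (hψ' : HasCompactSupport ψ) : Integrable (fun x => f x * ψ x) := by
  simpa [mul_comm] using
    hf.locallyIntegrable.integrable_smul_left_of_hasCompactSupport hψ hψ'

lemma IsLocL2.integrable_coeff_mul {σ f ψ : Plane → ℝ} {c : ℝ} (hσ : Measurable σ)
    (hc : ∀ x, |σ x| ≤ c) (hf : IsLocL2 f) (hψ : Continuous ψ)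
    (hψ' : HasCompactSupport ψ) : Integrable (fun x => σ x * (f x * ψ x)) :=
  (hf.integrable_mul hψ hψ').bdd_mul hσ.aestronglyMeasurable
    (Eventually.of_forall fun x => (Real.norm_eq_abs _).trans_le (hc x))

lemma IsLocL2.integrable_coeff_mul_inner {σ φ : Plane → ℝ} {G : Plane → Plane} {c : ℝ}
    (hσ : Measurable σ) (hc : ∀ x, |σ x| ≤ c) (hG : IsLocL2 G) (hφ : ContDiff ℝ ∞ φ)
    (hφ' : HasCompactSupport φ) : Integrable (fun x => σ x * inner ℝ (G x) (∇ φ x)) := by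
  simp only [inner_plane, mul_add]
  exact ((hG.apply 0).integrable_coeff_mul hσ hc (contDiff_gradient_apply hφ 0).continuous
      (hasCompactSupport_gradient_apply hφ' 0)).add
    ((hG.apply 1).integrable_coeff_mul hσ hc (contDiff_gradient_apply hφ 1).continuous
      (hasCompactSupport_gradient_apply hφ' 1))

lemma IsConductivitySolution.sub {σ u v : Plane → ℝ} {c : ℝ} (hσ : Measurable σ)
    (hc : ∀ x, |σ x| ≤ c) (hu : IsConductivitySolution σ u) (hv : IsConductivitySolution σ v) :
    IsConductivitySolution σ (fun x => u x - v x) := by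
  obtain ⟨hu, G, hG, hGu, hG0⟩ := hu
  obtain ⟨hv, H, hH, hHv, hH0⟩ := hv
  refine ⟨hu.sub hv, fun x => G x - H x, hG.sub hH, fun φ hφ hφ' i => ?_, fun φ hφ hφ' => ?_⟩
  · have c1 := (contDiff_gradient_apply hφ i).continuous
    have c2 := hasCompactSupport_gradient_apply hφ' i
    simp only [sub_mul, PiLp.sub_apply]
    rw [integral_sub (hu.integrable_mul c1 c2) (hv.integrable_mul c1 c2), hGu φ hφ hφ',
      hHv φ hφ hφ',
      integral_sub ((hG.apply i).integrable_mul hφ.continuous hφ')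
        ((hH.apply i).integrable_mul hφ.continuous hφ')]
    ring
  · simp only [inner_sub_left, mul_sub]
    rw [integral_sub (hG.integrable_coeff_mul_inner hσ hc hφ hφ')
      (hH.integrable_coeff_mul_inner hσ hc hφ hφ'), hG0 φ hφ hφ', hH0 φ hφ hφ', sub_zero]

lemma VanishesAtInfinity.sub {f g : Plane → ℝ} (hf : VanishesAtInfinity f)
    (hg : VanishesAtInfinity g) : VanishesAtInfinity (fun x => f x - g x) := fun ε hε => by
  obtain ⟨R, hR⟩ := hf (ε / 2) (by linarith)
  obtain ⟨S, hS⟩ := hg (ε / 2) (by linarith)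
  refine ⟨max R S, ?_⟩
  filter_upwards [hR, hS] with x h1 h2 hx
  have := abs_sub (f x) (g x)
  linarith [h1 ((le_max_left _ _).trans_lt hx), h2 ((le_max_right _ _).trans_lt hx)]

lemma gradient_sq_mul_apply {η v : Plane → ℝ} {x : Plane} (hη : DifferentiableAt ℝ η x)
    (hv : DifferentiableAt ℝ v x) (i : Fin 2) :
    (∇ (fun y => η y ^ 2 * v y) x) i =
      2 * η x * (∇ η x) i * v x + η x ^ 2 * (∇ v x) i := by
  have h : HasFDerivAt (fun y => η y ^ 2 * v y) _ x := (hη.hasFDerivAt.pow 2).mul hv.hasFDerivAt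
  simp only [gradient_apply, h.fderiv]
  simp
  ring

/-- The energy identity obtained by testing the equation with `η² w`. -/
lemma energy_identity {σ w η : Plane → ℝ} {G : Plane → Plane} {c : ℝ} (hσ : Measurable σ)
    (hc : ∀ x, |σ x| ≤ c) (hw : IsLocL2 w) (hG : IsLocL2 G) (hGw : IsWeakGradient w G)
    (hG0 : ∀ φ : Plane → ℝ, ContDiff ℝ ∞ φ → HasCompactSupport φ →
      ∫ x, σ x * inner ℝ (G x) (∇ φ x) = 0)
    (hη : ContDiff ℝ ∞ η) (hη' : HasCompactSupport η) :
    Integrable (fun x => ∑ i : Fin 2, (σ x * η x ^ 2 * G x i * G x i +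
      2 * σ x * η x * (∇ η x) i * G x i * w x)) ∧
    ∫ x, ∑ i : Fin 2, (σ x * η x ^ 2 * G x i * G x i +
      2 * σ x * η x * (∇ η x) i * G x i * w x) = 0 := by
  obtain ⟨R, hR⟩ := exists_radius_of_hasCompactSupport hη'
  obtain ⟨C, hC⟩ := exists_bound_of_hasCompactSupport hη' hη.continuous
  have hC0 : 0 ≤ C := (abs_nonneg _).trans (hC 0)
  have hc0 : 0 ≤ c := (abs_nonneg _).trans (hc 0)
  have hF : ∀ i : Fin 2, MemLp (fun x => σ x * η x ^ 2 * G x i) 2 := fun i => by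
    refine (hG.apply i).memLp_mul (h := fun x => σ x * η x ^ 2) (C := c * C ^ 2) (R := R)
      (hσ.aestronglyMeasurable.mul (hη.continuous.pow 2).aestronglyMeasurable) (fun x => ?_)
      (fun x hx => by simp [hR x hx])
    rw [abs_mul, abs_pow]
    gcongr
    exacts [hc x, hC x]
  have hF' : ∀ i : Fin 2, MemLp (fun x => 2 * σ x * η x * (∇ η x) i * G x i) 2 := fun i => by
    obtain ⟨K, hK⟩ := exists_bound_of_hasCompactSupport
      (hasCompactSupport_gradient_apply hη' i) (contDiff_gradient_apply hη i).continuous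
    refine (hG.apply i).memLp_mul (h := fun x => 2 * σ x * η x * (∇ η x) i)
      (C := 2 * c * C * K) (R := R)
      (((hσ.const_mul 2).aestronglyMeasurable.mul hη.continuous.aestronglyMeasurable).mul
        (contDiff_gradient_apply hη i).continuous.aestronglyMeasurable) (fun x => ?_)
      (fun x hx => by simp [hR x hx])
    rw [abs_mul, abs_mul, abs_mul, abs_of_pos (by norm_num : (0 : ℝ) < 2)]
    gcongr
    exacts [hc x, hC x, hK x]
  have t1 := fun i : Fin 2 => (hG.apply i).tendsto_integral_mul_mollify (hF i) (R := R)
    (fun x hx => by simp [hR x hx])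
  have t2 := fun i : Fin 2 => hw.tendsto_integral_mul_mollify (hF' i) (R := R)
    (fun x hx => by simp [hR x hx])
  have i1 : ∀ i : Fin 2, Integrable (fun x => σ x * η x ^ 2 * G x i * G x i) := fun i => by
    have := ((hF i).integrable_mul ((hG.apply i).memLp_indicator R))
    refine this.congr (Eventually.of_forall fun x => ?_)
    by_cases hx : ‖x‖ ≤ R
    · simp [Set.indicator_of_mem (show x ∈ Metric.closedBall (0 : Plane) R by simpa using hx)]
    · simp [hR x (not_le.1 hx)]
  have i2 : ∀ i : Fin 2, Integrable (fun x => 2 * σ x * η x * (∇ η x) i * G x i * w x) :=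
    fun i => by
      have := ((hF' i).integrable_mul (hw.memLp_indicator R))
      refine this.congr (Eventually.of_forall fun x => ?_)
      by_cases hx : ‖x‖ ≤ R
      · simp [Set.indicator_of_mem (show x ∈ Metric.closedBall (0 : Plane) R by simpa using hx)]
      · simp [hR x (not_le.1 hx)]
  have i3 : ∀ i : Fin 2, Integrable (fun x => σ x * η x ^ 2 * G x i * G x i +
      2 * σ x * η x * (∇ η x) i * G x i * w x) := fun i => (i1 i).add (i2 i)
  have i4 : ∀ (n : ℕ) (i : Fin 2), Integrable (fun x =>
      σ x * η x ^ 2 * G x i * mollify n (fun x => G x i) x +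
      2 * σ x * η x * (∇ η x) i * G x i * mollify n w x) :=
    fun n i => ((t1 i).1 n).add ((t2 i).1 n)
  refine ⟨integrable_finsetSum _ fun i _ => i3 i, ?_⟩
  rw [integral_finsetSum _ fun i _ => i3 i]
  simp_rw [fun i => integral_add (i1 i) (i2 i)]
  -- Test functions must be smooth, so `w` is mollified in `η² w`. The mollified factors enter
  -- linearly, hence weak convergence is enough to pass to the limit.
  refine tendsto_nhds_unique (tendsto_finsetSum _ fun i _ => (t1 i).2.add (t2 i).2) ?_
  refine tendsto_const_nhds.congr fun n => ?_
  have hsm := contDiff_mollify n hw.locallyIntegrable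
  have key := hG0 (fun x => η x ^ 2 * mollify n w x) ((hη.pow 2).mul hsm)
    ((hη'.comp_left (g := fun t : ℝ => t ^ 2) (by simp)).mul_right)
  rw [← key]
  simp_rw [← fun i => integral_add ((t1 i).1 n) ((t2 i).1 n)]
  rw [← integral_finsetSum _ fun i _ => i4 n i]
  refine integral_congr_ae (Eventually.of_forall fun x => ?_)
  simp only [inner_plane, Fin.sum_univ_two]
  rw [gradient_sq_mul_apply (hη.differentiable (by simp) x) (hsm.differentiable (by simp) x),
    gradient_sq_mul_apply (hη.differentiable (by simp) x) (hsm.differentiable (by simp) x),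
    hGw.gradient_mollify hw.locallyIntegrable, hGw.gradient_mollify hw.locallyIntegrable]
  ring

/-- Caccioppoli's inequality. -/
lemma caccioppoli {σ w η : Plane → ℝ} {G : Plane → Plane} {c : ℝ} (hσ : Measurable σ)
    (hc1 : 1 < c) (hc : ∀ x, c⁻¹ ≤ σ x ∧ σ x ≤ c) (hw : IsLocL2 w) (hG : IsLocL2 G)
    (hGw : IsWeakGradient w G)
    (hG0 : ∀ φ : Plane → ℝ, ContDiff ℝ ∞ φ → HasCompactSupport φ →
      ∫ x, σ x * inner ℝ (G x) (∇ φ x) = 0)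
    (hη : ContDiff ℝ ∞ η) (hη' : HasCompactSupport η) :
    Integrable (fun x => ∑ i : Fin 2, (η x * G x i) ^ 2) ∧
    Integrable (fun x => ∑ i : Fin 2, ((∇ η x) i * w x) ^ 2) ∧
    ∫ x, ∑ i : Fin 2, (η x * G x i) ^ 2 ≤
      4 * c ^ 2 * ∫ x, ∑ i : Fin 2, ((∇ η x) i * w x) ^ 2 := by
  have hc0 : 0 < c := by linarith
  have hσ0 : ∀ x, 0 < σ x := fun x => (inv_pos.2 hc0).trans_le (hc x).1
  obtain ⟨hI, h0⟩ := energy_identity hσ (c := c)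
    (fun x => by rw [abs_of_pos (hσ0 x)]; exact (hc x).2) hw hG hGw hG0 hη hη'
  obtain ⟨R, hR⟩ := exists_radius_of_hasCompactSupport hη'
  have j1 : Integrable (fun x => ∑ i : Fin 2, (η x * G x i) ^ 2) := by
    refine integrable_finsetSum _ fun i _ => MemLp.integrable_sq ?_
    obtain ⟨C, hC⟩ := exists_bound_of_hasCompactSupport hη' hη.continuous
    exact (hG.apply i).memLp_mul hη.continuous.aestronglyMeasurable hC hR
  have j2 : Integrable (fun x => ∑ i : Fin 2, ((∇ η x) i * w x) ^ 2) := by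
    refine integrable_finsetSum _ fun i _ => MemLp.integrable_sq ?_
    have hg := hasCompactSupport_gradient_apply hη' i
    have hgc := (contDiff_gradient_apply hη i).continuous
    obtain ⟨C, hC⟩ := exists_bound_of_hasCompactSupport hg hgc
    obtain ⟨S, hS⟩ := exists_radius_of_hasCompactSupport hg
    exact hw.memLp_mul hgc.aestronglyMeasurable hC hS
  refine ⟨j1, j2, ?_⟩
  -- This is `a² + 2ab ≥ a²/2 - 2b²` weighted by `c⁻¹ ≤ σ ≤ c`. Multiplication by `2c` at the end
  -- produces the constant `4c²`.
  have hpt : ∀ x, (2 * c)⁻¹ * ∑ i : Fin 2, (η x * G x i) ^ 2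
      - 2 * c * ∑ i : Fin 2, ((∇ η x) i * w x) ^ 2 ≤
      ∑ i : Fin 2, (σ x * η x ^ 2 * G x i * G x i +
      2 * σ x * η x * (∇ η x) i * G x i * w x) := fun x => by
    rw [Finset.mul_sum, Finset.mul_sum, ← Finset.sum_sub_distrib]
    refine Finset.sum_le_sum fun i _ => ?_
    set a := η x * G x i
    set b := (∇ η x) i * w x
    have e : σ x * η x ^ 2 * G x i * G x i + 2 * σ x * η x * (∇ η x) i * G x i * w x
        = σ x * (a ^ 2 + 2 * (a * b)) := by simp only [a, b]; ring
    have h1 : (2 * c)⁻¹ * a ^ 2 ≤ σ x * (a ^ 2 / 2) := by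
      rw [mul_inv]
      nlinarith [mul_le_mul_of_nonneg_right (hc x).1 (sq_nonneg a)]
    have h2 : σ x * (2 * b ^ 2) ≤ 2 * c * b ^ 2 := by
      nlinarith [mul_le_mul_of_nonneg_right (hc x).2 (sq_nonneg b)]
    have h3 : σ x * (a ^ 2 / 2 - 2 * b ^ 2) ≤ σ x * (a ^ 2 + 2 * (a * b)) :=
      mul_le_mul_of_nonneg_left (by nlinarith [sq_nonneg (a + 2 * b)]) (hσ0 x).le
    rw [e]
    linarith
  have := integral_mono ((j1.const_mul (2 * c)⁻¹).sub (j2.const_mul (2 * c))) hI hpt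
  rw [h0, integral_sub' (j1.const_mul _) (j2.const_mul _), integral_const_mul,
    integral_const_mul] at this
  rw [mul_inv] at this
  have h5 := mul_le_mul_of_nonneg_left this (by positivity : (0 : ℝ) ≤ 2 * c)
  rw [mul_sub, ← mul_assoc, show 2 * c * (2⁻¹ * c⁻¹) = 1 by field_simp] at h5
  linarith

/-! ### Cutoffs at scale `R` and the vanishing of solutions that are small at infinity -/

/-- A smooth cutoff equal to `1` on the unit ball. -/
noncomputable def unitCutoff : ContDiffBump (0 : Plane) where
  rIn := 1
  rOut := 2
  rIn_pos := one_pos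
  rIn_lt_rOut := one_lt_two

/-- The cutoff at scale `R`. -/
noncomputable def cutoff (R : ℝ) (x : Plane) : ℝ := unitCutoff (R⁻¹ • x)

lemma contDiff_cutoff (R : ℝ) : ContDiff ℝ ∞ (cutoff R) :=
  unitCutoff.contDiff.comp (contDiff_const_smul R⁻¹)

lemma cutoff_eq_one {R : ℝ} (hR : 0 < R) {x : Plane} (hx : ‖x‖ ≤ R) : cutoff R x = 1 := by
  refine unitCutoff.one_of_mem_closedBall ?_
  rw [mem_closedBall_zero_iff, norm_smul, Real.norm_of_nonneg (inv_nonneg.2 hR.le)]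
  change R⁻¹ * ‖x‖ ≤ 1
  rwa [inv_mul_le_iff₀ hR, mul_one]

lemma cutoff_eq_zero {R : ℝ} (hR : 0 < R) {x : Plane} (hx : 2 * R ≤ ‖x‖) : cutoff R x = 0 := by
  refine unitCutoff.zero_of_le_dist ?_
  rw [dist_zero_right, norm_smul, Real.norm_of_nonneg (inv_nonneg.2 hR.le)]
  change 2 ≤ R⁻¹ * ‖x‖
  rw [le_inv_mul_iff₀ hR]
  linarith

lemma hasCompactSupport_cutoff {R : ℝ} (hR : 0 < R) : HasCompactSupport (cutoff R) :=
  HasCompactSupport.intro (isCompact_closedBall (0 : Plane) (2 * R)) fun x hx =>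
    cutoff_eq_zero hR (by simpa using (not_le.1 (by simpa using hx)).le)

lemma gradient_cutoff_eq_zero_of_lt {R : ℝ} (hR : 0 < R) {x : Plane} (hx : ‖x‖ < R) (i : Fin 2) :
    (∇ (cutoff R) x) i = 0 := by
  have : cutoff R =ᶠ[𝓝 x] fun _ => 1 := by
    filter_upwards [continuous_norm.continuousAt.eventually (gt_mem_nhds hx)] with y hy
    exact cutoff_eq_one hR (le_of_lt hy)
  rw [gradient_apply, this.fderiv_eq]
  simp

lemma gradient_cutoff_eq_zero_of_gt {R : ℝ} (hR : 0 < R) {x : Plane} (hx : 2 * R < ‖x‖)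
    (i : Fin 2) : (∇ (cutoff R) x) i = 0 := by
  have : cutoff R =ᶠ[𝓝 x] fun _ => 0 := by
    filter_upwards [continuous_norm.continuousAt.eventually (lt_mem_nhds hx)] with y hy
    exact cutoff_eq_zero hR (le_of_lt hy)
  rw [gradient_apply, this.fderiv_eq]
  simp

lemma exists_abs_gradient_cutoff_le :
    ∃ C : ℝ, ∀ R : ℝ, 0 < R → ∀ (x : Plane) (i : Fin 2), |(∇ (cutoff R) x) i| ≤ C / R := by
  have hb := fun i => exists_bound_of_hasCompactSupport
    (hasCompactSupport_gradient_apply unitCutoff.hasCompactSupport i)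
    (contDiff_gradient_apply unitCutoff.contDiff i).continuous
  choose C hC using hb
  refine ⟨max (C 0) (C 1), fun R hR x i => ?_⟩
  have hd : HasFDerivAt (cutoff R) _ x :=
    ((unitCutoff.contDiff (n := ⊤)).differentiable (by simp) (R⁻¹ • x)).hasFDerivAt.comp x
      ((hasFDerivAt_id x).const_smul R⁻¹)
  have h1 : (∇ (cutoff R) x) i = R⁻¹ * (∇ unitCutoff (R⁻¹ • x)) i := by
    rw [gradient_apply, gradient_apply, hd.fderiv]
    simp
  rw [h1, abs_mul, abs_of_pos (inv_pos.2 hR), div_eq_inv_mul]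
  refine mul_le_mul_of_nonneg_left ((hC i _).trans ?_) (inv_nonneg.2 hR.le)
  fin_cases i
  exacts [le_max_left _ _, le_max_right _ _]

/-- The gradient of the cutoff is at most `C / R` per component and lives where `R ≤ |x| ≤ 2R`, a
region in which `|w| < ε`. Dimension two enters here: the area of the disc of radius `2R` cancels
`R⁻²`. The factor `8` is two components times `2²`. -/
lemma integral_gradient_cutoff_mul_sq_le {w : Plane → ℝ} {C ε S R : ℝ}
    (hR : 0 < R) (hSR : S < R)
    (hC : ∀ (x : Plane) (i : Fin 2), |(∇ (cutoff R) x) i| ≤ C / R)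
    (hw : ∀ᵐ x : Plane, S < ‖x‖ → |w x| < ε) :
    ∫ x, ∑ i : Fin 2, ((∇ (cutoff R) x) i * w x) ^ 2 ≤
      8 * C ^ 2 * volume.real (Metric.ball (0 : Plane) 1) * ε ^ 2 := by
  have hC0 : 0 ≤ C / R := (abs_nonneg _).trans (hC 0 0)
  calc ∫ x, ∑ i : Fin 2, ((∇ (cutoff R) x) i * w x) ^ 2
      ≤ ∫ x, (Metric.closedBall (0 : Plane) (2 * R)).indicator
          (fun _ => 2 * (C / R * ε) ^ 2) x := by
        refine integral_mono_of_nonneg (Eventually.of_forall fun x => by positivity)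
          ((integrable_indicator_iff Metric.isClosed_closedBall.measurableSet).2
            (integrableOn_const (isCompact_closedBall _ _).measure_lt_top.ne)) ?_
        filter_upwards [hw] with x hx
        by_cases h2 : 2 * R < ‖x‖
        · rw [Set.indicator_of_notMem (by simpa using h2)]
          simp [gradient_cutoff_eq_zero_of_gt hR h2]
        rw [Set.indicator_of_mem (by simpa using h2)]
        by_cases h1 : ‖x‖ < R
        · simp only [gradient_cutoff_eq_zero_of_lt hR h1]
          simp
          positivity
        have hwx := hx (hSR.trans_le (not_lt.1 h1))
        have : ∀ i : Fin 2, ((∇ (cutoff R) x) i * w x) ^ 2 ≤ (C / R * ε) ^ 2 := fun i => by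
          rw [← sq_abs, abs_mul]
          gcongr
          exact hC x i
        rw [Fin.sum_univ_two]
        linarith [this 0, this 1]
    _ = volume.real (Metric.closedBall (0 : Plane) (2 * R)) * (2 * (C / R * ε) ^ 2) := by
        rw [integral_indicator Metric.isClosed_closedBall.measurableSet]
        simp
    _ = _ := by
        rw [Measure.real, Measure.addHaar_closedBall _ _ (by positivity), ENNReal.toReal_mul,
          ENNReal.toReal_ofReal (by positivity), ← Measure.real]
        simp only [finrank_euclideanSpace, Fintype.card_fin]
        field_simp
        ring

/-- **Liouville theorem**: a weak solution in the whole plane which vanishes at infinity is zero. -/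
theorem IsConductivitySolution.ae_eq_zero {σ w : Plane → ℝ} {c : ℝ} (hσ : Measurable σ)
    (hc1 : 1 < c) (hc : ∀ x, c⁻¹ ≤ σ x ∧ σ x ≤ c) (hw : IsConductivitySolution σ w)
    (hv : VanishesAtInfinity w) : w =ᵐ[volume] 0 := by
  obtain ⟨hw, G, hG, hGw, hG0⟩ := hw
  have hc0 : 0 < c := by linarith
  obtain ⟨C, hC⟩ := exists_abs_gradient_cutoff_le
  set K := 4 * c ^ 2 * (8 * C ^ 2 * volume.real (Metric.ball (0 : Plane) 1)) with hK
  have hK0 : 0 ≤ K := by positivity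
  have hloc : ∀ (ρ : ℕ), ∫ x in Metric.closedBall (0 : Plane) ρ, ∑ i : Fin 2, (G x i) ^ 2 = 0 := by
    intro ρ
    refine le_antisymm (le_of_forall_pos_le_add fun δ hδ => ?_)
      (integral_nonneg fun x => by positivity)
    -- Chosen so that `K ε² ≤ δ`; the `+ 1` covers `K = 0`.
    set ε := √(δ / (K + 1)) with hε
    have hεpos : 0 < ε := Real.sqrt_pos.2 (by positivity)
    have hεsq : ε ^ 2 = δ / (K + 1) := Real.sq_sqrt (by positivity)
    obtain ⟨S, hS⟩ := hv ε hεpos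
    set R := max (ρ : ℝ) (|S| + 1) with hRdef
    have hR : 0 < R := lt_of_lt_of_le (by positivity) (le_max_right _ _)
    have hSR : S < R := lt_of_lt_of_le (by linarith [le_abs_self S]) (le_max_right _ _)
    obtain ⟨j1, -, hcac⟩ := caccioppoli hσ hc1 hc hw hG hGw hG0 (contDiff_cutoff R)
      (hasCompactSupport_cutoff hR)
    have h2 := integral_gradient_cutoff_mul_sq_le hR hSR (hC R hR) hS
    calc ∫ x in Metric.closedBall (0 : Plane) ρ, ∑ i : Fin 2, (G x i) ^ 2
        = ∫ x in Metric.closedBall (0 : Plane) ρ, ∑ i : Fin 2, (cutoff R x * G x i) ^ 2 := by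
          refine setIntegral_congr_fun Metric.isClosed_closedBall.measurableSet fun x hx => ?_
          have : ‖x‖ ≤ R := le_trans (by simpa using hx) (le_max_left _ _)
          simp [cutoff_eq_one hR this]
      _ ≤ ∫ x, ∑ i : Fin 2, (cutoff R x * G x i) ^ 2 :=
          setIntegral_le_integral j1 (Eventually.of_forall fun x => by positivity)
      _ ≤ K * ε ^ 2 := by
          refine hcac.trans ((mul_le_mul_of_nonneg_left h2 (by positivity)).trans_eq ?_)
          rw [hK]; ring
      _ ≤ 0 + δ := by
          rw [hεsq, zero_add, mul_div_assoc', div_le_iff₀ (by positivity)]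
          nlinarith
  have hG0 : ∀ᵐ x, ∀ i : Fin 2, G x i = 0 := by
    have : ∀ ρ : ℕ, ∀ᵐ x ∂(volume.restrict (Metric.closedBall (0 : Plane) ρ)),
        ∀ i : Fin 2, G x i = 0 := fun ρ => by
      have hi : Integrable (fun x => ∑ i : Fin 2, (G x i) ^ 2)
          (volume.restrict (Metric.closedBall (0 : Plane) ρ)) :=
        integrable_finsetSum _ fun i _ =>
          ((hG.apply i) _ (isCompact_closedBall _ _)).integrable_sq
      have := (integral_eq_zero_iff_of_nonneg (fun x => by positivity) hi).1 (hloc ρ)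
      filter_upwards [this] with x hx i
      have h := (Finset.sum_eq_zero_iff_of_nonneg (fun i _ => sq_nonneg (G x i))).1 hx i
        (Finset.mem_univ i)
      simpa using h
    have h := ae_restrict_iUnion_iff (μ := (volume : Measure Plane))
      (fun n : ℕ => Metric.closedBall (0 : Plane) n) (fun x => ∀ i : Fin 2, G x i = 0)
    rw [Metric.iUnion_closedBall_nat, Measure.restrict_univ] at h
    exact h.2 this
  -- Each mollification is smooth with zero gradient, hence constant. It averages `w` over a unit
  -- ball, and that ball can be moved as far out as desired, so the constant is zero.
  have hmol : ∀ n x, mollify n w x = 0 := by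
    intro n
    have hsm := contDiff_mollify n hw.locallyIntegrable
    have hgrad : ∀ x, fderiv ℝ (mollify n w) x = 0 := fun x => by
      have hz : ∇ (mollify n w) x = 0 := by
        ext i
        rw [hGw.gradient_mollify hw.locallyIntegrable, mollify_eq_integral_sub]
        rw [integral_eq_zero_of_ae]
        · simp
        · filter_upwards [hG0] with y hy
          simp [hy i]
      rw [← toDual_gradient, hz, map_zero]
    have hconst := is_const_of_fderiv_eq_zero (hsm.differentiable (by simp)) hgrad
    have hsmall : ∀ ε > 0, |mollify n w 0| ≤ ε := fun ε hε => by
      obtain ⟨R, hR⟩ := hv ε hε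
      obtain ⟨x, hx⟩ := NormedSpace.exists_lt_norm ℝ Plane (|R| + 1)
      rw [hconst 0 x, mollify_eq_integral_sub, ← Real.norm_eq_abs]
      have hi : Integrable (fun y => mollifier n (x - y) * ε) :=
        ((integrable_mollifier n).comp_sub_left x).mul_const ε
      refine (norm_integral_le_of_norm_le hi ?_).trans_eq ?_
      · filter_upwards [hR] with y hy
        rw [norm_mul, Real.norm_of_nonneg (mollifier_nonneg n _)]
        by_cases hxy : 1 < ‖x - y‖
        · simp [mollifier_eq_zero hxy]
        · refine mul_le_mul_of_nonneg_left (hy ?_).le (mollifier_nonneg n _)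
          have := norm_sub_norm_le x y
          linarith [le_abs_self R, not_lt.1 hxy]
      · rw [integral_mul_const, integral_sub_left_eq_self, integral_mollifier, one_mul]
    have h0 : mollify n w 0 = 0 :=
      abs_eq_zero.1 (le_antisymm (le_of_forall_pos_le_add fun ε hε => by
        simpa using hsmall ε hε) (abs_nonneg _))
    exact fun x => (hconst x 0).trans h0
  filter_upwards [ae_tendsto_mollify hw.locallyIntegrable] with x hx
  exact tendsto_nhds_unique hx (by simp [hmol])

/-! ### Absolutely continuous functions on intervals -/

lemma AbsolutelyContinuousOnInterval.lipschitz_comp {f g : ℝ → ℝ} {a b : ℝ} {K : NNReal}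
    (hf : AbsolutelyContinuousOnInterval f a b)
    (hg : LipschitzOnWith K g (f '' Set.uIcc a b)) :
    AbsolutelyContinuousOnInterval (fun x => g (f x)) a b := by
  unfold AbsolutelyContinuousOnInterval at hf ⊢
  have h' := hf.const_mul (K : ℝ)
  rw [mul_zero] at h'
  refine squeeze_zero' (Eventually.of_forall fun E => Finset.sum_nonneg fun _ _ => dist_nonneg)
    ?_ h'
  filter_upwards [mem_inf_of_right (mem_principal_self _)] with E hE
  rw [Finset.mul_sum]
  refine Finset.sum_le_sum fun i hi => ?_
  have := hE.1 i hi
  exact hg.dist_le_mul _ ⟨_, this.1, rfl⟩ _ ⟨_, this.2, rfl⟩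

lemma abs_exp_sub_exp_le {u v M : ℝ} (hu : u ≤ M) (hv : v ≤ M) :
    |Real.exp u - Real.exp v| ≤ Real.exp M * |u - v| := by
  wlog h : v ≤ u generalizing u v
  · rw [abs_sub_comm, abs_sub_comm u]
    exact this hv hu (le_of_not_ge h)
  rw [abs_of_nonneg (sub_nonneg.2 (Real.exp_le_exp.2 h)), abs_of_nonneg (sub_nonneg.2 h)]
  have h1 : Real.exp u - Real.exp v = Real.exp u * (1 - Real.exp (v - u)) := by
    rw [mul_sub, ← Real.exp_add]
    ring_nf
  have h2 := Real.add_one_le_exp (v - u)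
  rw [h1]
  calc Real.exp u * (1 - Real.exp (v - u)) ≤ Real.exp u * (u - v) :=
        mul_le_mul_of_nonneg_left (by linarith) (Real.exp_pos u).le
    _ ≤ _ := by
      have : 0 ≤ u - v := sub_nonneg.2 h
      gcongr

/-- The exponential is only locally Lipschitz; a bound for `f` on the interval supplies the
constant. -/
lemma AbsolutelyContinuousOnInterval.exp {f : ℝ → ℝ} {a b : ℝ}
    (hf : AbsolutelyContinuousOnInterval f a b) :
    AbsolutelyContinuousOnInterval (fun x => Real.exp (f x)) a b := by
  obtain ⟨M, hM⟩ := hf.exists_bound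
  refine hf.lipschitz_comp (K := (Real.exp M).toNNReal) (LipschitzOnWith.of_dist_le_mul ?_)
  rintro _ ⟨x, hx, rfl⟩ _ ⟨y, hy, rfl⟩
  rw [Real.dist_eq, Real.dist_eq, Real.coe_toNNReal _ (Real.exp_pos M).le]
  exact abs_exp_sub_exp_le ((le_abs_self _).trans (hM x hx)) ((le_abs_self _).trans (hM y hy))

lemma AbsolutelyContinuousOnInterval.integral_eq_sub {f f' : ℝ → ℝ} {a b : ℝ}
    (hf : AbsolutelyContinuousOnInterval f a b)
    (hf' : ∀ᵐ x, x ∈ Set.uIcc a b → HasDerivAt f (f' x) x) :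
    ∫ x in a..b, f' x = f b - f a := by
  rw [← hf.integral_deriv_eq_sub]
  refine intervalIntegral.integral_congr_ae ?_
  filter_upwards [hf'] with x hx hx'
  exact (hx (Set.uIoc_subset_uIcc hx')).deriv.symm

lemma AbsolutelyContinuousOnInterval.eq_of_ae_hasDerivAt_zero {f : ℝ → ℝ} {a b : ℝ}
    (hf : AbsolutelyContinuousOnInterval f a b)
    (hf' : ∀ᵐ x, x ∈ Set.uIcc a b → HasDerivAt f 0 x) : f a = f b := by
  have := hf.integral_eq_sub (f' := fun _ => 0) hf'
  simp at this
  linarith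

/-- The fundamental theorem of calculus with a vanishing limit at the left end point. -/
lemma eq_integral_of_tendsto_zero {A A' : ℝ → ℝ} {r : ℝ} (hr : 0 < r)
    (hi : IntervalIntegrable A' volume 0 r) (h : ∀ a, 0 < a → a ≤ r → ∫ x in a..r, A' x = A r - A a)
    (h0 : Tendsto A (𝓝[>] 0) (𝓝 0)) : A r = ∫ x in 0..r, A' x := by
  have hc := intervalIntegral.continuousOn_primitive_interval_left (μ := volume) (f := A')
    (a := 0) (b := r) (by rwa [Set.uIcc_of_le hr.le, integrableOn_Icc_iff_integrableOn_Ioc,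
      ← intervalIntegrable_iff_integrableOn_Ioc_of_le hr.le])
  have hc0 := hc 0 Set.left_mem_uIcc
  rw [Set.uIcc_of_le hr.le] at hc0
  have h1 : Tendsto (fun a => ∫ x in a..r, A' x) (𝓝[>] 0) (𝓝 (∫ x in 0..r, A' x)) :=
    (hc0.mono_of_mem_nhdsWithin (Icc_mem_nhdsGT hr)).tendsto
  have h2 : Tendsto (fun a => A r - A a) (𝓝[>] 0) (𝓝 (A r - 0)) := h0.const_sub _
  rw [sub_zero] at h2
  refine tendsto_nhds_unique (h2.congr' ?_) h1
  filter_upwards [Ioc_mem_nhdsGT hr] with a ha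
  exact (h a ha.1 ha.2).symm

lemma intervalIntegrable_of_bounded {f : ℝ → ℝ} (hf : Measurable f) {M : ℝ}
    (hM : ∀ x, |f x| ≤ M) (a b : ℝ) : IntervalIntegrable f volume a b := by
  rw [intervalIntegrable_iff]
  exact Measure.integrableOn_of_bounded (M := M) (by simp) hf.aestronglyMeasurable
    (Eventually.of_forall hM)

lemma intervalIntegrable_div_of_bounded {f : ℝ → ℝ} (hf : Measurable f) {M : ℝ}
    (hM : ∀ x, |f x| ≤ M) {a b : ℝ} (ha : 0 < a) (hb : 0 < b) :
    IntervalIntegrable (fun x => f x / x) volume a b := by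
  simp only [div_eq_mul_inv]
  refine (intervalIntegrable_of_bounded hf hM a b).mul_continuousOn
    (continuousOn_id.inv₀ fun x hx => ?_)
  exact ((lt_min ha hb).trans_le hx.1).ne'

lemma ContDiffOn.absolutelyContinuousOnInterval_of_pos {f : ℝ → ℝ}
    (hf : ContDiffOn ℝ 1 f (Set.Ioi 0)) {a b : ℝ} (ha : 0 < a) (hb : 0 < b) :
    AbsolutelyContinuousOnInterval f a b :=
  (hf.mono fun _ hx => (lt_min ha hb).trans_le hx.1).absolutelyContinuousOnInterval

/-! ### The Riccati equation of the radial problem -/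

/-- The truncation of a real number to `[c⁻¹, c]`. -/
noncomputable def truncate (c y : ℝ) : ℝ := max c⁻¹ (min c y)

lemma truncate_mem {c : ℝ} (hc : 1 < c) (y : ℝ) : c⁻¹ ≤ truncate c y ∧ truncate c y ≤ c :=
  ⟨le_max_left _ _, max_le ((inv_lt_one_of_one_lt₀ hc).le.trans hc.le) (min_le_left _ _)⟩

lemma truncate_of_mem {c y : ℝ} (h : c⁻¹ ≤ y ∧ y ≤ c) : truncate c y = y := by
  rw [truncate, min_eq_right h.2, max_eq_right h.1]

lemma abs_truncate_sub_le (c x y : ℝ) : |truncate c x - truncate c y| ≤ |x - y| := by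
  refine (abs_max_sub_max_le_max _ _ _ _).trans (max_le (by simp) ?_)
  exact (abs_min_sub_min_le_max _ _ _ _).trans (max_le (by simp) le_rfl)

lemma continuous_truncate (c : ℝ) : Continuous (truncate c) := by
  unfold truncate
  fun_prop

/-- The right-hand side of the Riccati equation `r q' = κ s - κ q² / s`, shifted by `(n + 1) q`. -/
noncomputable def riccatiRHS (κ : ℝ) (n : ℕ) (t y : ℝ) : ℝ := κ * t - κ / t * y ^ 2 + (n + 1) * y

/-- The second factor is nonnegative once `n + 1` dominates `κ (y + z) / t`. Monotonicity and the
Lipschitz bound in `y` are both read off from it. -/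
lemma riccatiRHS_sub (κ : ℝ) (n : ℕ) (t y z : ℝ) :
    riccatiRHS κ n t y - riccatiRHS κ n t z = (y - z) * ((n + 1) - κ / t * (y + z)) := by
  unfold riccatiRHS; ring

section Riccati

variable {κ c t : ℝ} {n : ℕ}

lemma riccati_slope_mem (hκ : 0 < κ) (hc : 1 < c) (ht : c⁻¹ ≤ t ∧ t ≤ c) {y z : ℝ}
    (hy : c⁻¹ ≤ y ∧ y ≤ c) (hz : c⁻¹ ≤ z ∧ z ≤ c) :
    2 * κ / c ^ 2 ≤ κ / t * (y + z) ∧ κ / t * (y + z) ≤ 2 * κ * c ^ 2 := by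
  have hc0 : 0 < c := by linarith
  have hci : 0 < c⁻¹ := inv_pos.2 hc0
  have ht0 : 0 < t := hci.trans_le ht.1
  have e1 : κ / c ≤ κ / t := div_le_div_of_nonneg_left hκ.le ht0 ht.2
  have e2 : κ / t ≤ κ * c := by
    rw [div_le_iff₀ ht0, mul_assoc]
    have : 1 ≤ c * t := by
      have := mul_le_mul_of_nonneg_left ht.1 hc0.le
      rwa [mul_inv_cancel₀ hc0.ne'] at this
    nlinarith
  constructor
  · calc 2 * κ / c ^ 2 = κ / c * (c⁻¹ + c⁻¹) := by field_simp; ring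
      _ ≤ _ := by
        have := hy.1; have := hz.1
        gcongr
  · calc κ / t * (y + z) ≤ κ * c * (c + c) := by
          have := hy.2; have := hz.2; have := hy.1; have := hz.1
          gcongr
          linarith
      _ = _ := by ring

/-- The Lipschitz constant is strictly below `n + 1`, and averaging against `x ^ n` divides by `n +
1`: this is the source of the contraction. -/
lemma abs_riccatiRHS_sub_le (hκ : 0 < κ) (hc : 1 < c) (hn : 2 * κ * c ^ 2 ≤ n + 1)
    (ht : c⁻¹ ≤ t ∧ t ≤ c) {y z : ℝ} (hy : c⁻¹ ≤ y ∧ y ≤ c) (hz : c⁻¹ ≤ z ∧ z ≤ c) :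
    |riccatiRHS κ n t y - riccatiRHS κ n t z| ≤ ((n + 1) - 2 * κ / c ^ 2) * |y - z| := by
  obtain ⟨h1, h2⟩ := riccati_slope_mem hκ hc ht hy hz
  rw [riccatiRHS_sub, abs_mul, mul_comm]
  gcongr
  rw [abs_of_nonneg (by linarith)]
  linarith

/-- By monotonicity only the end points matter. There `κ t - κ y² / t = κ (t - y) (t + y) / t` is
nonnegative for `y = c⁻¹` and nonpositive for `y = c`. -/
lemma riccatiRHS_mem (hκ : 0 < κ) (hc : 1 < c) (hn : 2 * κ * c ^ 2 ≤ n + 1)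
    (ht : c⁻¹ ≤ t ∧ t ≤ c) {y : ℝ} (hy : c⁻¹ ≤ y ∧ y ≤ c) :
    (n + 1) * c⁻¹ ≤ riccatiRHS κ n t y ∧ riccatiRHS κ n t y ≤ (n + 1) * c := by
  have hc0 : 0 < c := by linarith
  have hci : 0 < c⁻¹ := inv_pos.2 hc0
  have ht0 : 0 < t := hci.trans_le ht.1
  have hcc : c⁻¹ ≤ c := (inv_lt_one_of_one_lt₀ hc).le.trans hc.le
  constructor
  · have h := riccatiRHS_sub κ n t y c⁻¹
    obtain ⟨h1, h2⟩ := riccati_slope_mem hκ hc ht hy ⟨le_rfl, hcc⟩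
    have h3 : 0 ≤ (y - c⁻¹) * ((n + 1) - κ / t * (y + c⁻¹)) :=
      mul_nonneg (by linarith [hy.1]) (by linarith)
    have h4 : 0 ≤ κ * t - κ / t * c⁻¹ ^ 2 := by
      have : κ * t - κ / t * c⁻¹ ^ 2 = κ / t * ((t - c⁻¹) * (t + c⁻¹)) := by
        field_simp; ring
      rw [this]
      exact mul_nonneg (by positivity) (mul_nonneg (by linarith [ht.1]) (by positivity))
    have : riccatiRHS κ n t c⁻¹ = κ * t - κ / t * c⁻¹ ^ 2 + (n + 1) * c⁻¹ := rfl
    linarith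
  · have h := riccatiRHS_sub κ n t y c
    obtain ⟨h1, h2⟩ := riccati_slope_mem hκ hc ht hy ⟨hcc, le_rfl⟩
    have h3 : (y - c) * ((n + 1) - κ / t * (y + c)) ≤ 0 :=
      mul_nonpos_of_nonpos_of_nonneg (by linarith [hy.2]) (by linarith)
    have h4 : κ * t - κ / t * c ^ 2 ≤ 0 := by
      have : κ * t - κ / t * c ^ 2 = κ / t * ((t - c) * (t + c)) := by
        field_simp; ring
      rw [this]
      exact mul_nonpos_of_nonneg_of_nonpos (by positivity)
        (mul_nonpos_of_nonpos_of_nonneg (by linarith [ht.2]) (by positivity))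
    have : riccatiRHS κ n t c = κ * t - κ / t * c ^ 2 + (n + 1) * c := rfl
    linarith

end Riccati

/-- The weight `(n + 1) x ^ n / R ^ (n + 1)` has total mass one on `[0, R]`. -/
lemma integral_pow_mul_mem {H : ℝ → ℝ} (hH : Measurable H) {a b : ℝ}
    (hab : ∀ x, a ≤ H x ∧ H x ≤ b) (n : ℕ) {R : ℝ} (hR : 0 < R) :
    a / (n + 1) ≤ (∫ x in 0..R, x ^ n * H x) / R ^ (n + 1) ∧
      (∫ x in 0..R, x ^ n * H x) / R ^ (n + 1) ≤ b / (n + 1) := by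
  have hi : IntervalIntegrable (fun x => x ^ n * H x) volume 0 R :=
    (intervalIntegrable_of_bounded hH (M := max |a| |b|)
      (fun x => abs_le_max_abs_abs (hab x).1 (hab x).2) 0 R).continuousOn_mul
      (continuous_pow n).continuousOn
  have hc : ∀ k : ℝ, ∫ x in 0..R, x ^ n * k = R ^ (n + 1) * (k / (n + 1)) := fun k => by
    rw [intervalIntegral.integral_mul_const, integral_pow]
    simp
    ring
  have hp : 0 < R ^ (n + 1) := by positivity
  have hik : ∀ k : ℝ, IntervalIntegrable (fun x => x ^ n * k) volume 0 R := fun k =>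
    ((continuous_pow n).mul continuous_const).intervalIntegrable _ _
  rw [le_div_iff₀ hp, div_le_iff₀ hp, mul_comm, ← hc, mul_comm (b / _), ← hc]
  constructor
  · refine intervalIntegral.integral_mono_on hR.le (hik a) hi fun x hx => ?_
    exact mul_le_mul_of_nonneg_left (hab x).1 (pow_nonneg hx.1 n)
  · refine intervalIntegral.integral_mono_on hR.le hi (hik b) fun x hx => ?_
    exact mul_le_mul_of_nonneg_left (hab x).2 (pow_nonneg hx.1 n)

/-- The Riccati equation has a bounded solution on the half line. -/
lemma exists_riccati_solution {κ c : ℝ} (hκ : 0 < κ) (hc : 1 < c) {s : ℝ → ℝ}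
    (hs : Measurable s) (hsc : ∀ x, c⁻¹ ≤ s x ∧ s x ≤ c) :
    ∃ (n : ℕ) (q : ℝ → ℝ), Measurable q ∧ (∀ x, c⁻¹ ≤ q x ∧ q x ≤ c) ∧
      ∀ r, 0 < r → q r = (∫ x in 0..r, x ^ n * riccatiRHS κ n (s x) (q x)) / r ^ (n + 1) := by
  have hc0 : 0 < c := by linarith
  obtain ⟨n, hn'⟩ := exists_nat_ge (2 * κ * c ^ 2)
  have hn : 2 * κ * c ^ 2 ≤ n + 1 := by linarith
  have hn0 : (0 : ℝ) < n + 1 := by positivity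
  -- Since `(r ^ (n + 1) q)' = r ^ n (r q' + (n + 1) q)`, the Riccati equation is a fixed-point
  -- equation. The unknown is a function of `log r`, hence lives on all of `ℝ`. Truncation lets the
  -- map act on the whole Banach space; it is inactive at the fixed point, whose values lie in
  -- `[c⁻¹, c]`.
  let H : (BoundedContinuousFunction ℝ ℝ) → ℝ → ℝ :=
    fun q x => riccatiRHS κ n (s x) (truncate c (q (Real.log x)))
  have hHm : ∀ q, Measurable (H q) := fun q => by
    have h1 : Measurable fun x => truncate c (q (Real.log x)) :=
      (continuous_truncate c).measurable.comp (q.continuous.measurable.comp Real.measurable_log)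
    exact ((hs.const_mul κ).sub ((hs.const_div κ).mul (h1.pow_const 2))).add (h1.const_mul _)
  have hHb : ∀ q x, (n + 1) * c⁻¹ ≤ H q x ∧ H q x ≤ (n + 1) * c := fun q x =>
    riccatiRHS_mem hκ hc hn (hsc x) (truncate_mem hc _)
  let T : (BoundedContinuousFunction ℝ ℝ) → ℝ → ℝ :=
    fun q t => (∫ x in 0..Real.exp t, x ^ n * H q x) / Real.exp t ^ (n + 1)
  have hTb : ∀ q t, c⁻¹ ≤ T q t ∧ T q t ≤ c := fun q t => by
    have := integral_pow_mul_mem (hHm q) (hHb q) n (Real.exp_pos t)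
    simpa [mul_div_assoc, mul_div_cancel_left₀, hn0.ne'] using this
  have hii : ∀ q a b, IntervalIntegrable (fun x => x ^ n * H q x) volume a b := fun q a b =>
    (intervalIntegrable_of_bounded (hHm q) (M := (n + 1) * c) (fun x => by
      rw [abs_of_nonneg ((by positivity : 0 ≤ (n + 1) * c⁻¹).trans (hHb q x).1)]
      exact (hHb q x).2) a b).continuousOn_mul (continuous_pow n).continuousOn
  have hTc : ∀ q, Continuous (T q) := fun q => by
    refine ((intervalIntegral.continuous_primitive (hii q) 0).comp Real.continuous_exp).div
      (by fun_prop) fun t => by positivity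
  let S : (BoundedContinuousFunction ℝ ℝ) → (BoundedContinuousFunction ℝ ℝ) := fun q =>
    BoundedContinuousFunction.ofNormedAddCommGroup (T q) (hTc q) c fun t => by
      rw [Real.norm_of_nonneg ((inv_pos.2 hc0).le.trans (hTb q t).1)]
      exact (hTb q t).2
  have hk0 : 0 ≤ ((n + 1) - 2 * κ / c ^ 2) / (n + 1) := by
    refine div_nonneg ?_ hn0.le
    have : 2 * κ / c ^ 2 ≤ 2 * κ * c ^ 2 := by
      rw [div_le_iff₀ (by positivity)]
      have : 1 ≤ c ^ 2 * c ^ 2 := by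
        have := one_le_pow₀ hc.le (n := 4)
        linarith [show c ^ 2 * c ^ 2 = c ^ 4 by ring]
      nlinarith
    linarith
  have hlip : ∀ q q' t, |T q t - T q' t| ≤ ((n + 1) - 2 * κ / c ^ 2) / (n + 1) * dist q q' := by
    intro q q' t
    have e : T q t - T q' t
        = (∫ x in 0..Real.exp t, x ^ n * (H q x - H q' x)) / Real.exp t ^ (n + 1) := by
      simp only [T]
      rw [← sub_div, ← intervalIntegral.integral_sub (hii _ _ _) (hii _ _ _)]
      simp only [mul_sub]
    have hb : ∀ x, |H q x - H q' x| ≤ ((n + 1) - 2 * κ / c ^ 2) * dist q q' := fun x => by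
      refine (abs_riccatiRHS_sub_le hκ hc hn (hsc x) (truncate_mem hc _)
        (truncate_mem hc _)).trans ?_
      refine mul_le_mul_of_nonneg_left ?_ ?_
      · exact (abs_truncate_sub_le _ _ _).trans
          (BoundedContinuousFunction.dist_coe_le_dist (f := q) (g := q') (Real.log x))
      · have := mul_nonneg hk0 hn0.le
        rwa [div_mul_cancel₀ _ hn0.ne'] at this
    have := integral_pow_mul_mem ((hHm q).sub (hHm q')) (fun x => abs_le.1 (hb x)) n
      (Real.exp_pos t)
    rw [e, abs_le, div_mul_eq_mul_div]
    simpa only [neg_div, Pi.sub_apply] using this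
  have hS : ContractingWith (Real.toNNReal (((n + 1) - 2 * κ / c ^ 2) / (n + 1))) S := by
    refine ⟨?_, LipschitzWith.of_dist_le_mul fun q q' => ?_⟩
    · rw [Real.toNNReal_lt_one, div_lt_one hn0]
      have : 0 < 2 * κ / c ^ 2 := by positivity
      linarith
    · rw [Real.coe_toNNReal _ hk0]
      exact (BoundedContinuousFunction.dist_le (mul_nonneg hk0 dist_nonneg)).2 (hlip q q')
  set q := hS.fixedPoint S with hq
  have hfix : ∀ t, q t = T q t := fun t => by
    have h := hS.fixedPoint_isFixedPt
    exact (DFunLike.congr_fun h t).symm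
  have hqb : ∀ t, c⁻¹ ≤ q t ∧ q t ≤ c := fun t => by rw [hfix]; exact hTb q t
  refine ⟨n, fun x => q (Real.log x), q.continuous.measurable.comp Real.measurable_log,
    fun x => hqb _, fun r hr => ?_⟩
  simp only
  rw [hfix]
  simp only [T, H, Real.exp_log hr]
  congr 2
  ext x
  rw [truncate_of_mem (hqb _)]

/-! ### Locally absolutely continuous functions on the half line -/

/-- `F` is locally absolutely continuous on `(0, ∞)`, with almost everywhere derivative `F'`. -/
structure IsLocPrimitive (F F' : ℝ → ℝ) : Prop where
  absolutelyContinuous : ∀ a b, 0 < a → 0 < b → AbsolutelyContinuousOnInterval F a b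
  hasDerivAt : ∀ᵐ x, 0 < x → HasDerivAt F (F' x) x

namespace IsLocPrimitive

variable {F F' G G' : ℝ → ℝ}

lemma congr_deriv (hF : IsLocPrimitive F F') (h : ∀ x, 0 < x → F' x = G' x) :
    IsLocPrimitive F G' :=
  ⟨hF.1, hF.2.mono fun x hx h0 => h x h0 ▸ hx h0⟩

lemma add (hF : IsLocPrimitive F F') (hG : IsLocPrimitive G G') :
    IsLocPrimitive (fun x => F x + G x) (fun x => F' x + G' x) :=
  ⟨fun a b ha hb => (hF.1 a b ha hb).add (hG.1 a b ha hb), by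
    filter_upwards [hF.2, hG.2] with x h1 h2 hx using (h1 hx).add (h2 hx)⟩

lemma mul (hF : IsLocPrimitive F F') (hG : IsLocPrimitive G G') :
    IsLocPrimitive (fun x => F x * G x) (fun x => F' x * G x + F x * G' x) :=
  ⟨fun a b ha hb => (hF.1 a b ha hb).fun_mul (hG.1 a b ha hb), by
    filter_upwards [hF.2, hG.2] with x h1 h2 hx using (h1 hx).mul (h2 hx)⟩

lemma const_mul (hF : IsLocPrimitive F F') (k : ℝ) :
    IsLocPrimitive (fun x => k * F x) (fun x => k * F' x) :=
  ⟨fun a b ha hb => (hF.1 a b ha hb).const_mul k, by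
    filter_upwards [hF.2] with x h1 hx using (h1 hx).const_mul k⟩

lemma exp (hF : IsLocPrimitive F F') :
    IsLocPrimitive (fun x => Real.exp (F x)) (fun x => Real.exp (F x) * F' x) :=
  ⟨fun a b ha hb => (hF.1 a b ha hb).exp, by
    filter_upwards [hF.2] with x h1 hx using (h1 hx).exp⟩

lemma of_contDiffOn (hF : ContDiffOn ℝ 1 F (Set.Ioi 0))
    (hF' : ∀ x, 0 < x → HasDerivAt F (F' x) x) : IsLocPrimitive F F' :=
  ⟨fun _ _ ha hb => hF.absolutelyContinuousOnInterval_of_pos ha hb, Eventually.of_forall hF'⟩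

lemma pow (n : ℕ) : IsLocPrimitive (fun x => x ^ n) (fun x => n * x ^ n / x) := by
  refine of_contDiffOn (contDiff_id.pow n).contDiffOn fun x hx => ?_
  convert! hasDerivAt_pow n x using 1
  rcases n with _ | n
  · simp
  · rw [pow_succ, Nat.add_sub_cancel]
    field_simp

lemma inv_pow (n : ℕ) : IsLocPrimitive (fun x => (x ^ n)⁻¹) (fun x => -(n * (x ^ n)⁻¹ / x)) := by
  refine of_contDiffOn ((contDiff_id.pow n).contDiffOn.inv fun x hx => ?_) fun x hx => ?_
  · exact (pow_pos hx n).ne'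
  have h := (hasDerivAt_pow n x).inv (pow_pos hx n).ne'
  convert! h using 1
  rcases n with _ | n
  · simp
  · rw [Nat.add_sub_cancel, pow_succ]
    field_simp

/-- The base point is `1` because integrands such as `h x / x` may fail to be integrable at `0`. The
intervals `[1 / (N + 1), N + 1]` exhaust the half line. -/
lemma integral_one {k : ℝ → ℝ}
    (hk : ∀ a b, 0 < a → 0 < b → IntervalIntegrable k volume a b) :
    IsLocPrimitive (fun x => ∫ y in 1..x, k y) k := by
  refine ⟨fun a b ha hb => ?_, ?_⟩
  · set a' := min (min a b) 1
    set b' := max (max a b) 1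
    have ha' : 0 < a' := lt_min (lt_min ha hb) one_pos
    have hab : a' ≤ b' := (min_le_right _ _).trans (le_max_right _ _)
    have := (hk a' b' ha' (ha'.trans_le hab)).absolutelyContinuousOnInterval_intervalIntegral
      (c := 1) (by rw [Set.uIcc_of_le hab]; exact ⟨min_le_right _ _, le_max_right _ _⟩)
    refine this.mono ?_
    rw [Set.uIcc_of_le hab]
    exact Set.Icc_subset_Icc (min_le_left _ _) (le_max_left _ _)
  · have h : ∀ N : ℕ, ∀ᵐ x, x ∈ Set.uIcc (1 / ((N : ℝ) + 1)) (N + 1) →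
        HasDerivAt (fun x => ∫ y in 1..x, k y) (k x) x := fun N => by
      have hN : (0 : ℝ) < N + 1 := by positivity
      have h1 : 1 ≤ (N : ℝ) + 1 := by linarith [N.cast_nonneg (α := ℝ)]
      have h2 : 1 / ((N : ℝ) + 1) ≤ 1 := by rwa [div_le_one hN]
      filter_upwards [(hk (1 / ((N : ℝ) + 1)) (N + 1) (by positivity) hN).ae_hasDerivAt_integral]
        with x hx hx'
      exact hx hx' 1 (by rw [Set.uIcc_of_le (h2.trans h1)]; exact ⟨h2, h1⟩)
    filter_upwards [ae_all_iff.2 h] with x hx h0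
    obtain ⟨N, hN⟩ := exists_nat_ge (max x x⁻¹)
    have hN1 := (le_max_left _ _).trans hN
    have hN2 := (le_max_right _ _).trans hN
    have hN0 : (0 : ℝ) < N + 1 := by positivity
    have h3 : 1 / ((N : ℝ) + 1) ≤ x := by
      rw [div_le_iff₀ hN0]
      have := mul_le_mul_of_nonneg_left hN2 h0.le
      rw [mul_inv_cancel₀ h0.ne'] at this
      linarith
    refine hx N ?_
    rw [Set.uIcc_of_le (h3.trans (by linarith))]
    exact ⟨h3, by linarith⟩

lemma integral_zero {k : ℝ → ℝ} (hk : LocallyIntegrable k) :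
    IsLocPrimitive (fun x => ∫ y in 0..x, k y) k := by
  refine ⟨fun a b ha hb => ?_, ?_⟩
  · have hi : IntervalIntegrable k volume 0 (max a b) :=
      (hk.integrableOn_isCompact isCompact_uIcc).intervalIntegrable
    have := hi.absolutelyContinuousOnInterval_intervalIntegral (c := 0) Set.left_mem_uIcc
    refine this.mono ?_
    rw [Set.uIcc_of_le (ha.le.trans (le_max_left _ _))]
    exact Set.Icc_subset_Icc (le_min ha.le hb.le) le_rfl
  · filter_upwards [LocallyIntegrable.ae_hasDerivAt_integral hk] with x hx _
    exact hx 0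

lemma integral_eq (hF : IsLocPrimitive F F') {a b : ℝ} (ha : 0 < a) (hb : 0 < b) :
    ∫ x in a..b, F' x = F b - F a := by
  refine (hF.1 a b ha hb).integral_eq_sub ?_
  filter_upwards [hF.2] with x hx hx'
  exact hx ((lt_min ha hb).trans_le hx'.1)

lemma eq_of_deriv_eq_zero (hF : IsLocPrimitive F F') {R : ℝ} (hR : 0 ≤ R)
    (h : ∀ x, R < x → F' x = 0) {a b : ℝ} (ha : R < a) (hb : R < b) : F a = F b := by
  refine (hF.1 a b (hR.trans_lt ha) (hR.trans_lt hb)).eq_of_ae_hasDerivAt_zero ?_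
  filter_upwards [hF.2] with x hx hx'
  have h1 : R < x := (lt_min ha hb).trans_le hx'.1
  simpa [h x h1] using hx (hR.trans_lt h1)

end IsLocPrimitive

/-! ### Radial profiles -/

/-- `f` is the radial factor of a solution `f(r) cos (m θ)` of the conductivity equation with
radial conductivity `s`, in integrated form; `g` is `r f'(r)`. -/
structure IsRadialProfile (m : ℕ) (s f g : ℝ → ℝ) : Prop where
  measurable_left : Measurable f
  measurable_right : Measurable g
  bounded : ∀ ρ, ∃ C, ∀ r, 0 < r → r ≤ ρ → |f r| ≤ C
  -- The factor `m` in front of `|f r|` admits the constant profile for `m = 0`.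
  decay : ∃ δ : ℝ, 0 < δ ∧ ∀ ρ, ∃ C, ∀ r, 0 < r → r ≤ ρ →
    m * |f r| ≤ C * r ^ δ ∧ |g r| ≤ C * r ^ δ
  -- Both integrals start at `0`, so that integration by parts against a test function leaves no
  -- boundary term at the origin.
  mul_eq : ∀ r, 0 < r → r * f r = ∫ x in 0..r, (f x + g x)
  flux_eq : ∀ r, 0 < r → s r * g r = ∫ x in 0..r, m ^ 2 * s x * f x / x

lemma IsRadialProfile.const_mul {m : ℕ} {s f g : ℝ → ℝ} (h : IsRadialProfile m s f g) (k : ℝ) :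
    IsRadialProfile m s (fun r => k * f r) (fun r => k * g r) where
  measurable_left := h.1.const_mul k
  measurable_right := h.2.const_mul k
  bounded ρ := by
    obtain ⟨C, hC⟩ := h.bounded ρ
    refine ⟨|k| * C, fun r h0 h1 => ?_⟩
    rw [abs_mul]
    exact mul_le_mul_of_nonneg_left (hC r h0 h1) (abs_nonneg k)
  decay := by
    obtain ⟨δ, hδ, hd⟩ := h.decay
    refine ⟨δ, hδ, fun ρ => ?_⟩
    obtain ⟨C, hC⟩ := hd ρ
    refine ⟨|k| * C, fun r h0 h1 => ?_⟩
    obtain ⟨h2, h3⟩ := hC r h0 h1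
    rw [abs_mul, abs_mul, mul_left_comm, mul_assoc]
    exact ⟨mul_le_mul_of_nonneg_left h2 (abs_nonneg k),
      mul_le_mul_of_nonneg_left h3 (abs_nonneg k)⟩
  mul_eq r hr := by
    rw [mul_left_comm, h.mul_eq r hr, ← intervalIntegral.integral_const_mul]
    simp only [mul_add]
  flux_eq r hr := by
    rw [mul_left_comm, h.flux_eq r hr, ← intervalIntegral.integral_const_mul]
    congr 1
    ext x
    ring

lemma isRadialProfile_zero (s : ℝ → ℝ) : IsRadialProfile 0 s (fun _ => 1) (fun _ => 0) where
  measurable_left := measurable_const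
  measurable_right := measurable_const
  bounded _ := ⟨1, by simp⟩
  decay := ⟨1, one_pos, fun _ => ⟨0, by simp⟩⟩
  mul_eq r _ := by simp
  flux_eq r _ := by simp

/-- For `r ≤ 1` the lower bound on `h` gives `δ log r`; for `r ≥ 1` the upper bound gives at most `K
log ρ`. Exponentiated, this is growth `O(r ^ δ)` on `(0, ρ]`. -/
lemma integral_div_le {h : ℝ → ℝ} (hm : Measurable h) {δ K : ℝ} (hδ : 0 < δ)
    (hb : ∀ x, δ ≤ h x ∧ h x ≤ K) {r ρ : ℝ} (hr : 0 < r) (hrρ : r ≤ ρ) :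
    ∫ x in 1..r, h x / x ≤ δ * Real.log r + K * Real.log (max 1 ρ) := by
  have hK : 0 ≤ K := hδ.le.trans ((hb 0).1.trans (hb 0).2)
  have hlogρ : 0 ≤ Real.log (max 1 ρ) := Real.log_nonneg (le_max_left _ _)
  have hhM : ∀ x, |h x| ≤ K := fun x => by
    rw [abs_of_nonneg (hδ.le.trans (hb x).1)]
    exact (hb x).2
  have hi : ∀ {a b : ℝ}, 0 < a → 0 < b → IntervalIntegrable (fun x => h x / x) volume a b :=
    intervalIntegrable_div_of_bounded hm hhM
  have hic : ∀ (k : ℝ) {a b : ℝ}, 0 < a → 0 < b →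
      IntervalIntegrable (fun x => k / x) volume a b := fun k _ _ =>
    intervalIntegrable_div_of_bounded (f := fun _ => k) measurable_const (fun _ => le_rfl)
  have hlog : ∀ (k : ℝ) {a b : ℝ}, 0 < a → 0 < b → ∫ x in a..b, k / x = k * Real.log (b / a) :=
    fun k a b ha hb => by
      simp only [div_eq_mul_inv k]
      rw [intervalIntegral.integral_const_mul, integral_inv_of_pos ha hb]
  rcases le_total r 1 with h1 | h1
  · have : ∫ x in r..1, δ / x ≤ ∫ x in r..1, h x / x :=
      intervalIntegral.integral_mono_on h1 (hic δ hr one_pos) (hi hr one_pos) fun x hx =>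
        div_le_div_of_nonneg_right (hb x).1 (hr.le.trans hx.1)
    rw [hlog δ hr one_pos, one_div, Real.log_inv] at this
    rw [intervalIntegral.integral_symm]
    nlinarith [mul_nonneg hK hlogρ]
  · have : ∫ x in 1..r, h x / x ≤ ∫ x in 1..r, K / x :=
      intervalIntegral.integral_mono_on h1 (hi one_pos hr) (hic K one_pos hr) fun x hx =>
        div_le_div_of_nonneg_right (hb x).2 (zero_le_one.trans hx.1)
    rw [hlog K one_pos hr, div_one] at this
    have h2 : Real.log r ≤ Real.log (max 1 ρ) :=
      Real.log_le_log hr (hrρ.trans (le_max_right _ _))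
    nlinarith [mul_le_mul_of_nonneg_left h2 hK, mul_nonneg hδ.le (Real.log_nonneg h1)]

/-- A positive radial function with logarithmic derivative `κ q / (s r)` and its flux, where `q`
solves the Riccati equation. -/
lemma exists_positive_flux_pair {κ c : ℝ} (hκ : 0 < κ) (hc : 1 < c) {s : ℝ → ℝ}
    (hs : Measurable s) (hsc : ∀ x, c⁻¹ ≤ s x ∧ s x ≤ c) :
    ∃ E p : ℝ → ℝ, IsLocPrimitive E (fun r => p r / s r / r) ∧
      IsLocPrimitive p (fun r => κ ^ 2 * s r * E r / r) ∧
      (∀ r, 0 < r → 0 < E r) ∧ (∀ r, 0 < r → 0 < p r) ∧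
      ∃ δ K : ℝ, 0 < δ ∧ (∀ r, 0 < r → p r ≤ K * E r) ∧
        ∀ ρ, ∃ C, ∀ r, 0 < r → r ≤ ρ → E r ≤ C * r ^ δ := by
  have hc0 : 0 < c := by linarith
  have hci : 0 < c⁻¹ := inv_pos.2 hc0
  have hs0 : ∀ x, 0 < s x := fun x => hci.trans_le (hsc x).1
  obtain ⟨n, q, hqm, hqc, hq⟩ := exists_riccati_solution hκ hc hs hsc
  have hq0 : ∀ x, 0 < q x := fun x => hci.trans_le (hqc x).1
  set h : ℝ → ℝ := fun x => κ * q x / s x with hh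
  have hhm : Measurable h := (hqm.const_mul κ).div hs
  have hhb : ∀ x, κ * c⁻¹ / c ≤ h x ∧ h x ≤ κ * c / c⁻¹ := fun x => by
    have h1 := hsc x
    have h2 := hqc x
    have := hs0 x
    have := hq0 x
    constructor
    · simp only [hh]
      gcongr
      exacts [h2.1, h1.2]
    · simp only [hh]
      gcongr
      exacts [h2.2, h1.1]
  have hδ : 0 < κ * c⁻¹ / c := by positivity
  have hhi : ∀ a b, 0 < a → 0 < b → IntervalIntegrable (fun x => h x / x) volume a b :=
    fun a b ha hb => intervalIntegrable_div_of_bounded hhm (M := κ * c / c⁻¹) (fun x => by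
      rw [abs_of_nonneg (hδ.le.trans (hhb x).1)]; exact (hhb x).2) ha hb
  set E : ℝ → ℝ := fun r => Real.exp (∫ x in 1..r, h x / x) with hE
  have hEp : IsLocPrimitive E (fun r => E r * (h r / r)) := (IsLocPrimitive.integral_one hhi).exp
  set Φ : ℝ → ℝ := fun x => riccatiRHS κ n (s x) (q x) with hΦ
  -- `Q` equals `q` on `(0, ∞)` and is a product of two locally absolutely continuous functions, so
  -- its derivative is available.
  set Q : ℝ → ℝ := fun r => (∫ x in 0..r, x ^ n * Φ x) * (r ^ (n + 1))⁻¹ with hQ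
  have hqQ : ∀ r, 0 < r → q r = Q r := fun r hr => by rw [hq r hr, div_eq_mul_inv]
  have hΦm : Measurable Φ :=
    ((hs.const_mul κ).sub ((hs.const_div κ).mul (hqm.pow_const 2))).add (hqm.const_mul _)
  have hΦb : ∃ M, ∀ x, |Φ x| ≤ M := by
    refine ⟨κ * c + κ / c⁻¹ * c ^ 2 + (n + 1) * c, fun x => ?_⟩
    have h1 := hsc x
    have h2 := hqc x
    have h3 := hs0 x
    have h4 := hq0 x
    have e1 : κ * s x ≤ κ * c := by gcongr; exact h1.2
    have e2 : κ / s x * q x ^ 2 ≤ κ / c⁻¹ * c ^ 2 := by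
      gcongr
      exacts [h1.1, h2.2]
    have e3 : ((n : ℝ) + 1) * q x ≤ (n + 1) * c := by gcongr; exact h2.2
    have e4 : 0 ≤ κ * s x := by positivity
    have e5 : 0 ≤ κ / s x * q x ^ 2 := by positivity
    have e6 : 0 ≤ ((n : ℝ) + 1) * q x := by positivity
    simp only [hΦ, riccatiRHS, abs_le]
    constructor <;> linarith
  obtain ⟨M, hM⟩ := hΦb
  have hloc : LocallyIntegrable (fun x => x ^ n * Φ x) := by
    have : LocallyIntegrable Φ := by
      refine (locallyIntegrable_const M).mono hΦm.aestronglyMeasurable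
        (Eventually.of_forall fun x => ?_)
      exact (hM x).trans (le_abs_self M)
    refine locallyIntegrable_iff.2 fun K hK => ?_
    exact (this.integrableOn_isCompact hK).continuousOn_mul (continuous_pow n).continuousOn hK
  -- Differentiating `r ^ (-(n + 1))` contributes `-(n + 1) q / r`, which removes the shift and
  -- leaves the original Riccati equation.
  have hQp : IsLocPrimitive Q (fun r => (κ * s r - κ / s r * q r ^ 2) / r) := by
    refine ((IsLocPrimitive.integral_zero hloc).mul (IsLocPrimitive.inv_pow (n + 1))).congr_deriv
      fun r hr => ?_
    have h1 : (∫ x in 0..r, x ^ n * Φ x) = q r * r ^ (n + 1) := by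
      rw [hqQ r hr, hQ]
      simp only
      rw [inv_mul_cancel_right₀ (pow_pos hr _).ne']
    rw [h1]
    simp only [hΦ, riccatiRHS]
    have := hs0 r
    push_cast
    field_simp
    ring
  set p : ℝ → ℝ := fun r => κ * (Q r * E r) with hp
  have hpp : IsLocPrimitive p (fun r => κ ^ 2 * s r * E r / r) := by
    refine ((hQp.mul hEp).const_mul κ).congr_deriv fun r hr => ?_
    simp only [hh, ← hqQ r hr]
    have := hs0 r
    field_simp
    ring
  have hE0 : ∀ r, 0 < E r := fun r => Real.exp_pos _
  refine ⟨E, p, hEp.congr_deriv fun r hr => ?_, hpp, fun r _ => hE0 r, fun r hr => ?_,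
    κ * c⁻¹ / c, κ * c, hδ, fun r hr => ?_, fun ρ => ?_⟩
  · simp only [hp, hh, ← hqQ r hr]
    ring
  · simp only [hp, ← hqQ r hr]
    exact mul_pos hκ (mul_pos (hq0 r) (hE0 r))
  · simp only [hp, ← hqQ r hr]
    rw [← mul_assoc]
    have := (hqc r).2
    have := hE0 r
    gcongr
  · refine ⟨Real.exp (κ * c / c⁻¹ * Real.log (max 1 ρ)), fun r hr hrρ => ?_⟩
    rw [Real.rpow_def_of_pos hr, ← Real.exp_add, mul_comm (Real.log r), add_comm]
    exact Real.exp_le_exp.2 (integral_div_le hhm hδ hhb hr hrρ)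

lemma IsLocPrimitive.measurable_indicator {F F' : ℝ → ℝ} (hF : IsLocPrimitive F F') :
    Measurable ((Set.Ioi (0 : ℝ)).indicator F) := by
  have hc : ContinuousOn F (Set.Ioi 0) := fun x hx => by
    have hx0 : (0 : ℝ) < x := hx
    have h := (hF.1 (x / 2) (2 * x) (by positivity) (by positivity)).continuousOn
    rw [Set.uIcc_of_le (by linarith)] at h
    exact (h.continuousAt (Icc_mem_nhds (by linarith) (by linarith))).continuousWithinAt
  rw [← Set.piecewise_eq_indicator]
  exact hc.measurable_piecewise continuousOn_const measurableSet_Ioi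

lemma intervalIntegrable_of_bounded_zero {f : ℝ → ℝ} (hf : Measurable f) {r C δ : ℝ} (hδ : 0 < δ)
    (hC : ∀ x, 0 < x → x ≤ r → |f x| ≤ C * x ^ (δ - 1)) (hr : 0 < r) :
    IntervalIntegrable f volume 0 r := by
  refine ((intervalIntegral.intervalIntegrable_rpow' (r := δ - 1) (by linarith)).const_mul
    C).mono_fun' hf.aestronglyMeasurable ?_
  rw [Set.uIoc_of_le hr.le]
  filter_upwards [ae_restrict_mem measurableSet_Ioc] with x hx
  exact hC x hx.1 hx.2

lemma tendsto_zero_of_le_rpow {f : ℝ → ℝ} {C δ : ℝ} (hδ : 0 < δ)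
    (hC : ∀ x, 0 < x → x ≤ 1 → |f x| ≤ C * x ^ δ) : Tendsto f (𝓝[>] 0) (𝓝 0) := by
  have h : Tendsto (fun x : ℝ => C * x ^ δ) (𝓝[>] 0) (𝓝 0) := by
    have := ((Real.continuousAt_rpow_const 0 δ (Or.inr hδ.le)).tendsto.const_mul C).mono_left
      (nhdsWithin_le_nhds (s := Set.Ioi 0))
    simpa [Real.zero_rpow hδ.ne'] using this
  refine squeeze_zero_norm' ?_ h
  filter_upwards [Ioc_mem_nhdsGT one_pos] with x hx
  exact hC x hx.1 hx.2

/-- Existence of the radial factor, normalised at infinity. -/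
lemma exists_isRadialProfile (m : ℕ) {c : ℝ} (hc : 1 < c) {s : ℝ → ℝ} (hs : Measurable s)
    (hsc : ∀ x, c⁻¹ ≤ s x ∧ s x ≤ c) {R : ℝ} (hR : 0 ≤ R) (hs1 : ∀ r, R < r → s r = 1) :
    ∃ f g : ℝ → ℝ, IsRadialProfile m s f g ∧
      ∃ b : ℝ, (m = 0 → b = 0) ∧ ∀ r, R < r → f r = r ^ m + b / r ^ m := by
  rcases Nat.eq_zero_or_pos m with rfl | hm
  · exact ⟨_, _, isRadialProfile_zero s, 0, fun _ => rfl, by simp⟩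
  have hκ : (0 : ℝ) < m := by exact_mod_cast hm
  have hci : 0 < c⁻¹ := inv_pos.2 (by linarith)
  have hs0 : ∀ x, 0 < s x := fun x => hci.trans_le (hsc x).1
  obtain ⟨E, p, hE, hp, hE0, hp0, δ, K, hδ, hpK, hEC⟩ := exists_positive_flux_pair hκ hc hs hsc
  have hK0 : 0 < K := by
    have := (hp0 1 one_pos).trans_le (hpK 1 one_pos)
    exact pos_of_mul_pos_left this (hE0 1 one_pos).le
  -- `E` and `p` are controlled on `(0, ∞)` only; extension by zero makes them measurable on `ℝ`.
  set f := (Set.Ioi (0 : ℝ)).indicator E with hf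
  set g := fun r => (Set.Ioi (0 : ℝ)).indicator p r / s r with hg
  have hfE : ∀ r, 0 < r → f r = E r := fun r hr => Set.indicator_of_mem hr _
  have hgp : ∀ r, 0 < r → g r = p r / s r := fun r hr => by
    simp only [hg]; rw [Set.indicator_of_mem (Set.mem_Ioi.2 hr)]
  have hfm : Measurable f := hE.measurable_indicator
  have hgm : Measurable g := hp.measurable_indicator.div hs
  have hgE : ∀ r, 0 < r → |g r| ≤ K / c⁻¹ * E r := fun r hr => by
    have h1 := hp0 r hr
    have h2 := hs0 r
    have h3 := hE0 r hr
    rw [hgp r hr, abs_of_pos (by positivity), div_mul_eq_mul_div]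
    gcongr
    exacts [hpK r hr, (hsc r).1]
  have hprof : IsRadialProfile m s f g := by
    refine ⟨hfm, hgm, fun ρ => ?_, ⟨δ, hδ, fun ρ => ?_⟩, fun r hr => ?_, fun r hr => ?_⟩
    · obtain ⟨C, hC⟩ := hEC ρ
      refine ⟨|C| * ρ ^ δ, fun r hr hrρ => ?_⟩
      rw [hfE r hr, abs_of_pos (hE0 r hr)]
      refine (hC r hr hrρ).trans ?_
      gcongr
      exact le_abs_self C
    · obtain ⟨C, hC⟩ := hEC ρ
      refine ⟨max (m * C) (K / c⁻¹ * C), fun r hr hrρ => ?_⟩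
      have h1 := hC r hr hrρ
      have h0 : 0 ≤ r ^ δ := Real.rpow_nonneg hr.le δ
      rw [hfE r hr, abs_of_pos (hE0 r hr)]
      constructor
      · calc (m : ℝ) * E r ≤ m * C * r ^ δ := by rw [mul_assoc]; gcongr
          _ ≤ _ := mul_le_mul_of_nonneg_right (le_max_left _ _) h0
      · calc |g r| ≤ K / c⁻¹ * E r := hgE r hr
          _ ≤ K / c⁻¹ * C * r ^ δ := by rw [mul_assoc]; gcongr
          _ ≤ _ := mul_le_mul_of_nonneg_right (le_max_right _ _) h0
    · have hA : IsLocPrimitive (fun r => r * E r) (fun r => f r + g r) := by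
        have := ((IsLocPrimitive.pow 1).mul hE).congr_deriv (G' := fun r => f r + g r)
          fun x hx => by
            rw [hfE x hx, hgp x hx]
            have := hs0 x
            field_simp
            simp
        simpa only [pow_one] using this
      obtain ⟨C, hC⟩ := hEC (max 1 r)
      have hb : ∀ x, 0 < x → x ≤ max 1 r → |f x + g x| ≤ (1 + K / c⁻¹) * |C| * x ^ δ :=
        fun x hx hxr => by
          have h1 := hC x hx hxr
          have h2 := hgE x hx
          have h3 : |f x| = E x := by rw [hfE x hx, abs_of_pos (hE0 x hx)]
          have h4 : C * x ^ δ ≤ |C| * x ^ δ :=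
            mul_le_mul_of_nonneg_right (le_abs_self C) (Real.rpow_nonneg hx.le δ)
          have h5 : 0 < K / c⁻¹ := by positivity
          have h6 : (1 + K / c⁻¹) * E x ≤ (1 + K / c⁻¹) * (|C| * x ^ δ) := by
            gcongr
            linarith
          have := abs_add_le (f x) (g x)
          linarith
      rw [hfE r hr]
      refine eq_integral_of_tendsto_zero (A := fun r => r * E r) hr ?_
        (fun a ha har => hA.integral_eq ha hr) ?_
      · refine intervalIntegrable_of_bounded_zero (hfm.add hgm)
          (C := (1 + K / c⁻¹) * |C|) (δ := δ + 1) (by linarith)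
          (fun x hx hxr => ?_) hr
        simpa using hb x hx (hxr.trans (le_max_right _ _))
      · refine tendsto_zero_of_le_rpow (C := C) (δ := δ) hδ fun x hx hx1 => ?_
        rw [abs_of_pos (mul_pos hx (hE0 x hx))]
        have := hE0 x hx
        exact (mul_le_of_le_one_left this.le hx1).trans (hC x hx (hx1.trans (le_max_left _ _)))
    · have hA : IsLocPrimitive p (fun x => m ^ 2 * s x * f x / x) :=
        hp.congr_deriv fun x hx => by rw [hfE x hx]
      obtain ⟨C, hC⟩ := hEC (max 1 r)
      rw [hgp r hr, mul_div_cancel₀ _ (hs0 r).ne']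
      refine eq_integral_of_tendsto_zero hr ?_ (fun a ha har => hA.integral_eq ha hr) ?_
      · refine intervalIntegrable_of_bounded_zero (((hs.const_mul _).mul hfm).div measurable_id)
          (C := m ^ 2 * c * C) hδ (fun x hx hxr => ?_) hr
        have h1 := hE0 x hx
        have h2 := hs0 x
        have h3 := hC x hx (hxr.trans (le_max_right _ _))
        have h4 := (hsc x).2
        change |m ^ 2 * s x * f x / x| ≤ _
        rw [hfE x hx, abs_of_pos (by positivity), Real.rpow_sub_one hx.ne', mul_div_assoc',
          mul_assoc _ C]
        gcongr
      · refine tendsto_zero_of_le_rpow (C := K * C) (δ := δ) hδ fun x hx hx1 => ?_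
        rw [abs_of_pos (hp0 x hx), mul_assoc]
        exact (hpK x hx).trans
          (mul_le_mul_of_nonneg_left (hC x hx (hx1.trans (le_max_left _ _))) hK0.le)
  -- Where `s = 1`, these combinations diagonalise the system: `r (m E ± p)' = ± m (m E ± p)`. Hence
  -- they are multiples of `r ^ m` and `r ^ (-m)`.
  have hEp : IsLocPrimitive (fun r => m * E r + p r)
      (fun r => m * (p r / s r / r) + m ^ 2 * s r * E r / r) := (hE.const_mul m).add hp
  have hEm : IsLocPrimitive (fun r => m * E r + -1 * p r)
      (fun r => m * (p r / s r / r) + -1 * (m ^ 2 * s r * E r / r)) :=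
    (hE.const_mul m).add (hp.const_mul (-1))
  have hR1 : R < R + 1 := by linarith
  set α := ((R + 1) ^ m)⁻¹ * (m * E (R + 1) + p (R + 1)) with hα
  set β := (R + 1) ^ m * (m * E (R + 1) + -1 * p (R + 1)) with hβ
  have hα' : ∀ r, R < r → (r ^ m)⁻¹ * (m * E r + p r) = α := fun r hr => by
    refine ((IsLocPrimitive.inv_pow m).mul hEp).eq_of_deriv_eq_zero hR (fun x hx => ?_) hr hR1
    rw [hs1 x hx]
    ring
  have hβ' : ∀ r, R < r → r ^ m * (m * E r + -1 * p r) = β := fun r hr => by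
    refine ((IsLocPrimitive.pow m).mul hEm).eq_of_deriv_eq_zero hR (fun x hx => ?_) hr hR1
    rw [hs1 x hx]
    ring
  -- Positivity of `E` and `p` excludes a vanishing coefficient of `r ^ m`, so the profile can be
  -- divided by it.
  have hα0 : 0 < α := by
    have h1 : 0 < R + 1 := by linarith
    have := hE0 _ h1
    have := hp0 _ h1
    positivity
  refine ⟨_, _, hprof.const_mul (2 * m / α), β / α, fun h => absurd h hm.ne', fun r hr => ?_⟩
  have hr0 : 0 < r := hR.trans_lt hr
  have hrm : 0 < r ^ m := pow_pos hr0 m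
  have h1 := hα' r hr
  have h2 := hβ' r hr
  rw [inv_mul_eq_iff_eq_mul₀ hrm.ne'] at h1
  have h3 : m * E r + -1 * p r = β / r ^ m := by rw [eq_div_iff hrm.ne', mul_comm]; exact h2
  have h4 : 2 * m * E r = r ^ m * α + β / r ^ m := by linarith
  rw [hfE r hr0, div_mul_eq_mul_div, h4]
  field_simp

/-! ### Polar coordinates in the plane -/

/-- The point of the plane with polar coordinates `p`. -/
noncomputable def polarPoint (p : ℝ × ℝ) : Plane := !₂[p.1 * Real.cos p.2, p.1 * Real.sin p.2]

/-- The domain of polar coordinates. -/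
noncomputable def polarDomain : Set (ℝ × ℝ) := Set.Ioi 0 ×ˢ Set.Ioo (-Real.pi) Real.pi

lemma measurableSet_polarDomain : MeasurableSet polarDomain :=
  measurableSet_Ioi.prod measurableSet_Ioo

lemma continuous_polarPoint : Continuous polarPoint := by
  unfold polarPoint
  refine (PiLp.continuous_toLp 2 _).comp (continuous_pi fun i => ?_)
  fin_cases i
  · exact continuous_fst.mul (Real.continuous_cos.comp continuous_snd)
  · exact continuous_fst.mul (Real.continuous_sin.comp continuous_snd)

lemma norm_polarPoint {r : ℝ} (hr : 0 ≤ r) (θ : ℝ) : ‖polarPoint (r, θ)‖ = r := by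
  rw [EuclideanSpace.norm_eq, Fin.sum_univ_two]
  simp only [polarPoint, Real.norm_eq_abs, sq_abs]
  simp only [Matrix.cons_val_zero, Matrix.cons_val_one]
  rw [show (r * Real.cos θ) ^ 2 + (r * Real.sin θ) ^ 2 = r ^ 2 by
    rw [mul_pow, mul_pow, ← mul_add, Real.cos_sq_add_sin_sq, mul_one]]
  exact Real.sqrt_sq hr

lemma polarAngle_polarPoint {p : ℝ × ℝ} (hp : p ∈ polarDomain) :
    polarAngle (polarPoint p) = p.2 := by
  have := Complex.arg_mul_cos_add_sin_mul_I (r := p.1) hp.1 (θ := p.2) ⟨hp.2.1, hp.2.2.le⟩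
  rw [← this, polarAngle]
  congr 1
  apply Complex.ext <;> simp [polarPoint, Complex.cos_ofReal_re, Complex.sin_ofReal_re]

lemma integral_polar (F : Plane → ℝ) :
    ∫ x, F x = ∫ p in polarDomain, p.1 * F (polarPoint p) := by
  have h1 := (EuclideanSpace.volume_preserving_symm_measurableEquiv_toLp (Fin 2)).trans
    (volume_preserving_finTwoArrow ℝ)
  have h2 := h1.symm.integral_comp' F
  rw [← h2, ← integral_comp_polarCoord_symm]
  refine setIntegral_congr_fun measurableSet_polarDomain fun p _ => ?_
  rw [smul_eq_mul]
  congr 2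

lemma measurable_polarAngle : Measurable polarAngle := by
  refine Complex.measurable_arg.comp ?_
  have : (fun x : Plane => (⟨x 0, x 1⟩ : ℂ)) = fun x => (x 0 : ℂ) + (x 1 : ℂ) * Complex.I := by
    ext x
    apply Complex.ext <;> simp
  rw [this]
  fun_prop

/-! ### Polar derivatives of test functions -/

section Derivatives

variable {φ : Plane → ℝ}

/-- The radial derivative in polar coordinates. -/
noncomputable def radialDeriv (φ : Plane → ℝ) (p : ℝ × ℝ) : ℝ :=
  (∇ φ (polarPoint p)) 0 * Real.cos p.2 + (∇ φ (polarPoint p)) 1 * Real.sin p.2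

/-- The angular derivative in polar coordinates. -/
noncomputable def angularDeriv (φ : Plane → ℝ) (p : ℝ × ℝ) : ℝ :=
  p.1 * (-(∇ φ (polarPoint p)) 0 * Real.sin p.2 + (∇ φ (polarPoint p)) 1 * Real.cos p.2)

lemma fderiv_eq_gradient (φ : Plane → ℝ) (x v : Plane) :
    fderiv ℝ φ x v = (∇ φ x) 0 * v 0 + (∇ φ x) 1 * v 1 := by
  rw [← inner_gradient_left, inner_plane]

lemma hasDerivAt_toLp {a b : ℝ → ℝ} {a' b' t : ℝ} (ha : HasDerivAt a a' t)
    (hb : HasDerivAt b b' t) : HasDerivAt (fun t => (!₂[a t, b t] : Plane)) !₂[a', b'] t := by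
  have h : HasDerivAt (fun t => ![a t, b t]) ![a', b'] t := by
    rw [hasDerivAt_pi]
    intro i
    fin_cases i
    exacts [ha, hb]
  exact ((PiLp.continuousLinearEquiv 2 ℝ (fun _ : Fin 2 => ℝ)).symm.hasFDerivAt).comp_hasDerivAt t h

lemma hasDerivAt_polar_radial (hφ : Differentiable ℝ φ) (r θ : ℝ) :
    HasDerivAt (fun r => φ (polarPoint (r, θ))) (radialDeriv φ (r, θ)) r := by
  have h : HasDerivAt (fun r => polarPoint (r, θ)) !₂[Real.cos θ, Real.sin θ] r := by
    simpa using! hasDerivAt_toLp ((hasDerivAt_id r).mul_const (Real.cos θ))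
      ((hasDerivAt_id r).mul_const (Real.sin θ))
  have := (hφ (polarPoint (r, θ))).hasFDerivAt.comp_hasDerivAt r h
  rw [fderiv_eq_gradient] at this
  exact this

lemma hasDerivAt_polar_angular (hφ : Differentiable ℝ φ) (r θ : ℝ) :
    HasDerivAt (fun θ => φ (polarPoint (r, θ))) (angularDeriv φ (r, θ)) θ := by
  have h : HasDerivAt (fun θ => polarPoint (r, θ)) !₂[r * -Real.sin θ, r * Real.cos θ] θ :=
    hasDerivAt_toLp ((Real.hasDerivAt_cos θ).const_mul r) ((Real.hasDerivAt_sin θ).const_mul r)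
  have := (hφ (polarPoint (r, θ))).hasFDerivAt.comp_hasDerivAt θ h
  rw [fderiv_eq_gradient] at this
  convert! this using 1
  simp [angularDeriv]
  ring

lemma continuous_radialDeriv (hφ : ContDiff ℝ ∞ φ) : Continuous (radialDeriv φ) := by
  have h := fun i => (contDiff_gradient_apply hφ i).continuous.comp continuous_polarPoint
  exact ((h 0).mul (by fun_prop)).add ((h 1).mul (by fun_prop))

lemma continuous_angularDeriv (hφ : ContDiff ℝ ∞ φ) : Continuous (angularDeriv φ) := by
  have h := fun i => (contDiff_gradient_apply hφ i).continuous.comp continuous_polarPoint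
  exact continuous_fst.mul (((h 0).neg.mul (by fun_prop)).add ((h 1).mul (by fun_prop)))

/-- The Jacobian factor `r` is kept on the left to avoid any division by `r`. -/
lemma gradient_apply_zero_eq (r θ : ℝ) :
    r * (∇ φ (polarPoint (r, θ))) 0 =
      r * (Real.cos θ * radialDeriv φ (r, θ)) - Real.sin θ * angularDeriv φ (r, θ) := by
  simp only [radialDeriv, angularDeriv]
  linear_combination (-r * (∇ φ (polarPoint (r, θ))) 0) * Real.cos_sq_add_sin_sq θ

lemma gradient_apply_one_eq (r θ : ℝ) :
    r * (∇ φ (polarPoint (r, θ))) 1 =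
      r * (Real.sin θ * radialDeriv φ (r, θ)) + Real.cos θ * angularDeriv φ (r, θ) := by
  simp only [radialDeriv, angularDeriv]
  linear_combination (-r * (∇ φ (polarPoint (r, θ))) 1) * Real.cos_sq_add_sin_sq θ

lemma exists_radius_polar (hφ : HasCompactSupport φ) :
    ∃ ρ : ℝ, 0 < ρ ∧ ∀ r θ, ρ ≤ r → φ (polarPoint (r, θ)) = 0 ∧
      radialDeriv φ (r, θ) = 0 ∧ angularDeriv φ (r, θ) = 0 := by
  obtain ⟨R, hR⟩ := exists_radius_of_hasCompactSupport hφ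
  obtain ⟨R0, hR0⟩ := exists_radius_of_hasCompactSupport (hasCompactSupport_gradient_apply hφ 0)
  obtain ⟨R1, hR1⟩ := exists_radius_of_hasCompactSupport (hasCompactSupport_gradient_apply hφ 1)
  refine ⟨|R| + |R0| + |R1| + 1, by positivity, fun r θ hr => ?_⟩
  have h0 : 0 ≤ r := le_trans (by positivity) hr
  have hn := norm_polarPoint h0 θ
  have a0 := abs_nonneg R
  have a1 := abs_nonneg R0
  have a2 := abs_nonneg R1
  have e1 := hR (polarPoint (r, θ)) (by linarith [le_abs_self R])
  have e2 := hR0 (polarPoint (r, θ)) (by linarith [le_abs_self R0])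
  have e3 := hR1 (polarPoint (r, θ)) (by linarith [le_abs_self R1])
  simp [radialDeriv, angularDeriv, e1, e2, e3]

end Derivatives

/-! ### Fubini and integration by parts in polar coordinates -/

section IntegrationByParts

variable {A α : ℝ → ℝ} {Ψ : ℝ × ℝ → ℝ} {ρ : ℝ}

/-- The part of the domain of polar coordinates inside a disc. -/
noncomputable def polarRect (ρ : ℝ) : Set (ℝ × ℝ) :=
  Set.Ioc 0 ρ ×ˢ Set.Ioo (-Real.pi) Real.pi

lemma measurableSet_polarRect (ρ : ℝ) : MeasurableSet (polarRect ρ) :=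
  measurableSet_Ioc.prod measurableSet_Ioo

lemma polarRect_subset (ρ : ℝ) : polarRect ρ ⊆ polarDomain :=
  Set.prod_mono (fun _ h => h.1) subset_rfl

lemma eq_zero_of_mem_diff (hΨ0 : ∀ r θ, ρ ≤ r → Ψ (r, θ) = 0) :
    ∀ p ∈ polarDomain \ polarRect ρ, Ψ p = 0 := fun p hp => by
  refine hΨ0 p.1 p.2 (le_of_not_ge fun h => hp.2 ?_)
  exact ⟨⟨hp.1.1, h⟩, hp.1.2⟩

lemma integrableOn_polarRect (hρ : 0 < ρ) (hA : IntervalIntegrable A volume 0 ρ)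
    (hα : Continuous α) (hΨ : Continuous Ψ) :
    IntegrableOn (fun p : ℝ × ℝ => A p.1 * α p.2 * Ψ p) (polarRect ρ) := by
  have hA' : Integrable A (volume.restrict (Set.Ioc 0 ρ)) :=
    (intervalIntegrable_iff_integrableOn_Ioc_of_le hρ.le).1 hA
  have hα' : Integrable α (volume.restrict (Set.Ioo (-Real.pi) Real.pi)) :=
    (hα.integrableOn_Icc (a := -Real.pi) (b := Real.pi)).mono_set Set.Ioo_subset_Icc_self
  have h := hA'.mul_prod hα'
  rw [Measure.prod_restrict] at h
  have hK : IsCompact (Set.Icc 0 ρ ×ˢ Set.Icc (-Real.pi) Real.pi) :=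
    isCompact_Icc.prod isCompact_Icc
  obtain ⟨M, hM⟩ := hK.exists_bound_of_continuousOn hΨ.continuousOn
  refine Integrable.mul_bdd (c := M) h hΨ.aestronglyMeasurable ?_
  filter_upwards [ae_restrict_mem (measurableSet_polarRect ρ)] with p hp
  exact hM p ⟨Set.Ioc_subset_Icc_self hp.1, Set.Ioo_subset_Icc_self hp.2⟩

lemma integrableOn_polarDomain (hρ : 0 < ρ) (hA : IntervalIntegrable A volume 0 ρ)
    (hα : Continuous α) (hΨ : Continuous Ψ) (hΨ0 : ∀ r θ, ρ ≤ r → Ψ (r, θ) = 0) :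
    IntegrableOn (fun p : ℝ × ℝ => A p.1 * α p.2 * Ψ p) polarDomain :=
  (integrableOn_polarRect hρ hA hα hΨ).of_forall_sdiff_eq_zero measurableSet_polarDomain
    fun p hp => by rw [eq_zero_of_mem_diff hΨ0 p hp, mul_zero]

lemma setIntegral_polarDomain_eq (hΨ0 : ∀ r θ, ρ ≤ r → Ψ (r, θ) = 0) :
    ∫ p in polarDomain, A p.1 * α p.2 * Ψ p = ∫ p in polarRect ρ, A p.1 * α p.2 * Ψ p :=
  (setIntegral_eq_of_subset_of_forall_sdiff_eq_zero measurableSet_polarDomain (polarRect_subset ρ)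
    fun p hp => by rw [eq_zero_of_mem_diff hΨ0 p hp, mul_zero])

lemma setIntegral_polarDomain_radial (hρ : 0 < ρ) (hA : IntervalIntegrable A volume 0 ρ)
    (hα : Continuous α) (hΨ : Continuous Ψ) (hΨ0 : ∀ r θ, ρ ≤ r → Ψ (r, θ) = 0) :
    ∫ p in polarDomain, A p.1 * α p.2 * Ψ p =
      ∫ θ in Set.Ioo (-Real.pi) Real.pi, α θ * ∫ r in 0..ρ, A r * Ψ (r, θ) := by
  have hi := integrableOn_polarRect hρ hA hα hΨ
  rw [setIntegral_polarDomain_eq hΨ0]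
  rw [IntegrableOn, polarRect, Measure.volume_eq_prod, ← Measure.prod_restrict] at hi
  rw [polarRect, Measure.volume_eq_prod, ← Measure.prod_restrict, integral_prod_symm _ hi]
  refine integral_congr_ae (Eventually.of_forall fun θ => ?_)
  simp only
  rw [intervalIntegral.integral_of_le hρ.le, ← integral_const_mul]
  refine integral_congr_ae (Eventually.of_forall fun r => ?_)
  simp only
  ring

lemma setIntegral_polarDomain_angular (hρ : 0 < ρ) (hA : IntervalIntegrable A volume 0 ρ)
    (hα : Continuous α) (hΨ : Continuous Ψ) (hΨ0 : ∀ r θ, ρ ≤ r → Ψ (r, θ) = 0) :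
    ∫ p in polarDomain, A p.1 * α p.2 * Ψ p =
      ∫ r in Set.Ioc 0 ρ, A r * ∫ θ in -Real.pi..Real.pi, α θ * Ψ (r, θ) := by
  have hi := integrableOn_polarRect hρ hA hα hΨ
  rw [setIntegral_polarDomain_eq hΨ0]
  rw [IntegrableOn, polarRect, Measure.volume_eq_prod, ← Measure.prod_restrict] at hi
  rw [polarRect, Measure.volume_eq_prod, ← Measure.prod_restrict, integral_prod _ hi]
  refine integral_congr_ae (Eventually.of_forall fun r => ?_)
  simp only
  rw [intervalIntegral.integral_of_le (by linarith [Real.pi_pos]), integral_Ioc_eq_integral_Ioo,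
    ← integral_const_mul]
  refine integral_congr_ae (Eventually.of_forall fun θ => ?_)
  simp only
  ring

/-- Both boundary terms vanish: the primitive is zero at `0` and `ψ` is zero at `ρ`. As `A'` is
merely integrable, the absolutely continuous version of integration by parts is used. -/
lemma integral_primitive_mul_deriv {A' ψ ψ' : ℝ → ℝ} (hρ : 0 < ρ)
    (hA' : IntervalIntegrable A' volume 0 ρ) (hA : ∀ r, 0 < r → A r = ∫ x in 0..r, A' x)
    (hψ : ∀ r, HasDerivAt ψ (ψ' r) r) (hψ' : Continuous ψ') (hψ0 : ψ ρ = 0) :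
    ∫ r in 0..ρ, A r * ψ' r = -∫ r in 0..ρ, A' r * ψ r := by
  have hac : AbsolutelyContinuousOnInterval (fun r => ∫ x in 0..r, A' x) 0 ρ :=
    hA'.absolutelyContinuousOnInterval_intervalIntegral Set.left_mem_uIcc
  have hderiv : deriv ψ = ψ' := funext fun r => (hψ r).deriv
  have hψac : AbsolutelyContinuousOnInterval ψ 0 ρ := by
    refine ContDiffOn.absolutelyContinuousOnInterval (ContDiff.contDiffOn ?_)
    exact contDiff_one_iff_deriv.2 ⟨fun r => (hψ r).differentiableAt, by rwa [hderiv]⟩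
  have h := hac.integral_mul_deriv_eq_deriv_mul hψac
  simp only [hψ0, mul_zero, intervalIntegral.integral_same, zero_mul, sub_zero, zero_sub,
    hderiv] at h
  have e1 : ∫ r in 0..ρ, A r * ψ' r = ∫ r in 0..ρ, (∫ x in 0..r, A' x) * ψ' r := by
    refine intervalIntegral.integral_congr_ae (Eventually.of_forall fun r hr => ?_)
    rw [Set.uIoc_of_le hρ.le] at hr
    rw [hA r hr.1]
  rw [e1, h]
  congr 1
  refine intervalIntegral.integral_congr_ae ?_
  filter_upwards [hA'.ae_hasDerivAt_integral] with r hr hr'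
  rw [(hr (Set.uIoc_subset_uIcc hr') 0 Set.left_mem_uIcc).deriv]

end IntegrationByParts

/-- The divergence theorem, in polar coordinates, for a vector field with separated variables. -/
lemma integral_polar_divergence {A A' B α β β' : ℝ → ℝ} {φ : Plane → ℝ}
    (hA' : ∀ ρ, 0 < ρ → IntervalIntegrable A' volume 0 ρ)
    (hA : ∀ r, 0 < r → A r = ∫ x in 0..r, A' x)
    (hB : ∀ ρ, 0 < ρ → IntervalIntegrable B volume 0 ρ) (hα : Continuous α)
    (hβ : ∀ θ, HasDerivAt β (β' θ) θ) (hβ' : Continuous β')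
    (hper : β (-Real.pi) = β Real.pi) (hφ : ContDiff ℝ ∞ φ) (hφ' : HasCompactSupport φ) :
    ∫ p in polarDomain, (A p.1 * α p.2 * radialDeriv φ p + B p.1 * β p.2 * angularDeriv φ p) =
      -∫ p in polarDomain, (A' p.1 * α p.2 + B p.1 * β' p.2) * φ (polarPoint p) := by
  obtain ⟨ρ, hρ, h0⟩ := exists_radius_polar hφ'
  have hd : Differentiable ℝ φ := hφ.differentiable (by simp)
  have hβc : Continuous β := continuous_iff_continuousAt.2 fun θ => (hβ θ).continuousAt
  have hAi : IntervalIntegrable A volume 0 ρ := by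
    have : IntervalIntegrable (fun r => ∫ x in 0..r, A' x) volume 0 ρ :=
      ((hA' ρ hρ).absolutelyContinuousOnInterval_intervalIntegral
        Set.left_mem_uIcc).continuousOn.intervalIntegrable
    refine this.congr fun r hr => ?_
    rw [Set.uIoc_of_le hρ.le] at hr
    exact (hA r hr.1).symm
  have c1 := continuous_radialDeriv hφ
  have c2 := continuous_angularDeriv hφ
  have c3 : Continuous fun p => φ (polarPoint p) := hφ.continuous.comp continuous_polarPoint
  have z1 := fun r θ hr => (h0 r θ hr).2.1
  have z2 := fun r θ hr => (h0 r θ hr).2.2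
  have z3 : ∀ r θ, ρ ≤ r → (fun p => φ (polarPoint p)) (r, θ) = 0 := fun r θ hr => (h0 r θ hr).1
  simp only [add_mul]
  rw [integral_add (integrableOn_polarDomain hρ hAi hα c1 z1)
      (integrableOn_polarDomain hρ (hB ρ hρ) hβc c2 z2),
    integral_add (integrableOn_polarDomain hρ (hA' ρ hρ) hα c3 z3)
      (integrableOn_polarDomain hρ (hB ρ hρ) hβ' c3 z3), neg_add]
  congr 1
  · rw [setIntegral_polarDomain_radial hρ hAi hα c1 z1,
      setIntegral_polarDomain_radial hρ (hA' ρ hρ) hα c3 z3, ← integral_neg]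
    refine integral_congr_ae (Eventually.of_forall fun θ => ?_)
    simp only
    rw [integral_primitive_mul_deriv hρ (hA' ρ hρ) hA
      (fun r => hasDerivAt_polar_radial hd r θ) (by fun_prop) (z3 ρ θ le_rfl), mul_neg]
  · rw [setIntegral_polarDomain_angular hρ (hB ρ hρ) hβc c2 z2,
      setIntegral_polarDomain_angular hρ (hB ρ hρ) hβ' c3 z3, ← integral_neg]
    refine integral_congr_ae (Eventually.of_forall fun r => ?_)
    simp only
    rw [intervalIntegral.integral_mul_deriv_eq_deriv_mul (fun θ _ => hβ θ)
      (fun θ _ => hasDerivAt_polar_angular hd r θ) (hβ'.intervalIntegrable _ _)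
      (Continuous.intervalIntegrable (by fun_prop) _ _), hper]
    -- Both ends of the angular interval give the same point, so with `hper` the boundary terms
    -- cancel.
    have : polarPoint (r, -Real.pi) = polarPoint (r, Real.pi) := by simp [polarPoint]
    rw [this]
    ring

/-! ### Existence of the solution -/

/-- The function `f(r) cos (m θ)`. -/
noncomputable def modeFunction (m : ℕ) (f : ℝ → ℝ) (x : Plane) : ℝ :=
  f ‖x‖ * Real.cos (m * polarAngle x)

/-- The gradient of `f(r) cos (m θ)`, where `g(r) = r f'(r)`. -/
noncomputable def modeGradient (m : ℕ) (f g : ℝ → ℝ) (x : Plane) : Plane :=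
  !₂[(g ‖x‖ * Real.cos (m * polarAngle x) * Real.cos (polarAngle x) +
      m * f ‖x‖ * Real.sin (m * polarAngle x) * Real.sin (polarAngle x)) / ‖x‖,
    (g ‖x‖ * Real.cos (m * polarAngle x) * Real.sin (polarAngle x) -
      m * f ‖x‖ * Real.sin (m * polarAngle x) * Real.cos (polarAngle x)) / ‖x‖]

lemma isLocL2_of_closedBall {F : Type*} [NormedAddCommGroup F] {f : Plane → F}
    (h : ∀ ρ : ℝ, 0 < ρ → MemLp f 2 (volume.restrict (Metric.closedBall 0 ρ))) : IsLocL2 f := by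
  intro K hK
  obtain ⟨R, hR⟩ := hK.isBounded.subset_closedBall (0 : Plane)
  refine (h (max R 1) (by positivity)).mono_measure (Measure.restrict_mono ?_ le_rfl)
  exact hR.trans (Metric.closedBall_subset_closedBall (le_max_left _ _))

/-- In polar coordinates the squared function becomes `r ^ (2δ - 2) * r = r ^ (2δ - 1)`, integrable
at `0` for every `δ > 0`. Hence any positive decay rate of a profile gives finite energy. -/
lemma memLp_norm_rpow {δ ρ : ℝ} (hδ : 0 < δ) :
    MemLp (fun x : Plane => ‖x‖ ^ (δ - 1)) 2 (volume.restrict (Metric.closedBall 0 ρ)) := by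
  have hm : Measurable fun x : Plane => ‖x‖ ^ (δ - 1) := by fun_prop
  rw [memLp_two_iff_integrable_sq hm.aestronglyMeasurable, ← IntegrableOn,
    ← integrable_indicator_iff Metric.isClosed_closedBall.measurableSet]
  have h := (integrable_fun_norm_addHaar (volume : Measure Plane)
    (f := (Set.Iic ρ).indicator fun y : ℝ => (y ^ (δ - 1)) ^ 2)).2 ?_
  · refine h.congr (Eventually.of_forall fun x => ?_)
    beta_reduce
    by_cases hx : ‖x‖ ≤ ρ
    · rw [Set.indicator_of_mem (Set.mem_Iic.2 hx),
        Set.indicator_of_mem (mem_closedBall_zero_iff.2 hx)]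
    · rw [Set.indicator_of_notMem (show ‖x‖ ∉ Set.Iic ρ from hx),
        Set.indicator_of_notMem (mt mem_closedBall_zero_iff.1 hx)]
  · have hi : IntegrableOn (fun y : ℝ => y ^ (2 * δ - 1)) (Set.Ioc 0 ρ) := by
      rcases le_total 0 ρ with h0 | h0
      · exact (intervalIntegrable_iff_integrableOn_Ioc_of_le h0).1
          (intervalIntegral.intervalIntegrable_rpow' (by linarith))
      · simp [Set.Ioc_eq_empty (not_lt.2 h0)]
    have hi' := (integrable_indicator_iff measurableSet_Ioc).2 hi
    refine (hi'.integrableOn (s := Set.Ioi 0)).congr_fun (fun y hy => ?_) measurableSet_Ioi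
    have hy0 : (0 : ℝ) < y := hy
    simp only [Set.indicator_apply, Set.mem_Ioc, Set.mem_Iic, hy0, true_and, smul_eq_mul,
      finrank_euclideanSpace, Fintype.card_fin]
    split_ifs
    · rw [show 2 * δ - 1 = 1 + (δ - 1) + (δ - 1) by ring, Real.rpow_add hy0, Real.rpow_add hy0]
      simp
      ring
    · simp

namespace IsRadialProfile

variable {m : ℕ} {s f g : ℝ → ℝ}

lemma isLocL2_modeFunction (h : IsRadialProfile m s f g) : IsLocL2 (modeFunction m f) := by
  refine isLocL2_of_closedBall fun ρ hρ => ?_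
  obtain ⟨C, hC⟩ := h.bounded ρ
  have : IsFiniteMeasure ((volume : Measure Plane).restrict (Metric.closedBall 0 ρ)) :=
    ⟨by simpa using (isCompact_closedBall (0 : Plane) ρ).measure_lt_top (μ := volume)⟩
  have hm : Measurable (modeFunction m f) :=
    (h.measurable_left.comp measurable_norm).mul
      (Real.measurable_cos.comp (measurable_polarAngle.const_mul _))
  refine MemLp.of_bound hm.aestronglyMeasurable (max C |f 0|) ?_
  filter_upwards [ae_restrict_mem Metric.isClosed_closedBall.measurableSet] with x hx
  rw [modeFunction, norm_mul]
  refine (mul_le_of_le_one_right (norm_nonneg _) (Real.abs_cos_le_one _)).trans ?_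
  rcases (norm_nonneg x).eq_or_lt with h0 | h0
  · rw [← h0]; exact le_max_right _ _
  · exact (hC _ h0 (by simpa using hx)).trans (le_max_left _ _)

lemma isLocL2_modeGradient (h : IsRadialProfile m s f g) : IsLocL2 (modeGradient m f g) := by
  refine isLocL2_of_closedBall fun ρ hρ => ?_
  obtain ⟨δ, hδ, hd⟩ := h.decay
  obtain ⟨C, hC⟩ := hd ρ
  have hf : Measurable fun x : Plane => f ‖x‖ := h.measurable_left.comp measurable_norm
  have hg : Measurable fun x : Plane => g ‖x‖ := h.measurable_right.comp measurable_norm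
  have hθ := measurable_polarAngle
  have hm : Measurable (modeGradient m f g) := by
    refine (PiLp.continuous_toLp 2 _).measurable.comp (measurable_pi_iff.2 fun i => ?_)
    fin_cases i
    · exact ((((hg.mul (hθ.const_mul _).cos).mul hθ.cos).add
        (((hf.const_mul _).mul (hθ.const_mul _).sin).mul hθ.sin)).div measurable_norm)
    · exact ((((hg.mul (hθ.const_mul _).cos).mul hθ.sin).sub
        (((hf.const_mul _).mul (hθ.const_mul _).sin).mul hθ.cos)).div measurable_norm)
  refine (memLp_norm_rpow (ρ := ρ) hδ).of_le_mul (c := 4 * C) hm.aestronglyMeasurable ?_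
  filter_upwards [ae_restrict_mem Metric.isClosed_closedBall.measurableSet,
    ae_restrict_of_ae (Measure.ae_ne volume (0 : Plane))] with x hx hx0
  have h0 : 0 < ‖x‖ := norm_pos_iff.2 hx0
  obtain ⟨h1, h2⟩ := hC ‖x‖ h0 (by simpa using hx)
  set θ := polarAngle x
  have hb : ∀ a b a' b' : ℝ, |a| ≤ 1 → |b| ≤ 1 → |a'| ≤ 1 → |b'| ≤ 1 →
      |g ‖x‖ * a * b| + |m * f ‖x‖ * a' * b'| ≤ 2 * (C * ‖x‖ ^ δ) := by
    intro a b a' b' ha hb ha' hb'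
    have e : ∀ y u v : ℝ, |u| ≤ 1 → |v| ≤ 1 → |y * u * v| ≤ |y| := fun y u v hu hv => by
      rw [abs_mul, abs_mul]
      exact mul_le_of_le_one_right (by positivity) hv |>.trans
        (mul_le_of_le_one_right (abs_nonneg _) hu)
    have e1 := e (g ‖x‖) a b ha hb
    have e2 := e (m * f ‖x‖) a' b' ha' hb'
    rw [abs_mul (m : ℝ), Nat.abs_cast] at e2
    linarith
  have hc := Real.abs_cos_le_one
  have hs := Real.abs_sin_le_one
  have k0 := (abs_add_le _ _).trans (hb _ _ _ _ (hc (m * θ)) (hc θ) (hs (m * θ)) (hs θ))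
  have k1 := (abs_sub _ _).trans (hb _ _ _ _ (hc (m * θ)) (hs θ) (hs (m * θ)) (hc θ))
  have hn : ‖modeGradient m f g x‖ ≤ |modeGradient m f g x 0| + |modeGradient m f g x 1| := by
    rw [EuclideanSpace.norm_eq, Fin.sum_univ_two]
    refine Real.sqrt_le_iff.2 ⟨by positivity, ?_⟩
    simp only [Real.norm_eq_abs]
    nlinarith [abs_nonneg (modeGradient m f g x 0), abs_nonneg (modeGradient m f g x 1)]
  refine hn.trans ?_
  have l0 : |modeGradient m f g x 0| ≤ 2 * (C * ‖x‖ ^ δ) / ‖x‖ := by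
    change |_ / ‖x‖| ≤ _
    rw [abs_div, abs_of_pos h0]
    exact div_le_div_of_nonneg_right k0 h0.le
  have l1 : |modeGradient m f g x 1| ≤ 2 * (C * ‖x‖ ^ δ) / ‖x‖ := by
    change |_ / ‖x‖| ≤ _
    rw [abs_div, abs_of_pos h0]
    exact div_le_div_of_nonneg_right k1 h0.le
  rw [Real.norm_of_nonneg (by positivity), Real.rpow_sub_one h0.ne']
  refine (add_le_add l0 l1).trans_eq ?_
  ring

lemma intervalIntegrable_left (h : IsRadialProfile m s f g) {ρ : ℝ} (hρ : 0 < ρ) :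
    IntervalIntegrable f volume 0 ρ := by
  obtain ⟨C, hC⟩ := h.bounded ρ
  exact intervalIntegrable_of_bounded_zero h.measurable_left (δ := 1) one_pos
    (fun x h0 hx => by simpa using hC x h0 hx) hρ

lemma intervalIntegrable_right (h : IsRadialProfile m s f g) {ρ : ℝ} (hρ : 0 < ρ) :
    IntervalIntegrable g volume 0 ρ := by
  obtain ⟨δ, hδ, hd⟩ := h.decay
  obtain ⟨C, hC⟩ := hd ρ
  exact intervalIntegrable_of_bounded_zero h.measurable_right (δ := δ + 1) (by linarith)
    (fun x h0 hx => by simpa using (hC x h0 hx).2) hρ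

lemma intervalIntegrable_flux (h : IsRadialProfile m s f g) (hs : Measurable s) {c : ℝ}
    (hc : ∀ x, |s x| ≤ c) {ρ : ℝ} (hρ : 0 < ρ) :
    IntervalIntegrable (fun x => m * s x * f x / x) volume 0 ρ := by
  obtain ⟨δ, hδ, hd⟩ := h.decay
  obtain ⟨C, hC⟩ := hd ρ
  have hc0 : 0 ≤ c := (abs_nonneg _).trans (hc 0)
  refine intervalIntegrable_of_bounded_zero (C := c * C) (((hs.const_mul _).mul
    h.measurable_left).div measurable_id) hδ (fun x h0 hx => ?_) hρ
  change |m * s x * f x / x| ≤ _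
  have h1 : |m * s x * f x| ≤ c * (C * x ^ δ) := by
    rw [mul_comm (m : ℝ), mul_assoc, abs_mul, abs_mul, Nat.abs_cast]
    have := (hC x h0 hx).1
    have := hc x
    gcongr
  rw [abs_div, abs_of_pos h0, Real.rpow_sub_one h0.ne', mul_div_assoc', mul_assoc c]
  exact div_le_div_of_nonneg_right h1 h0.le

/-- In the polar frame a coordinate vector has components `(cos θ, -sin θ)` or `(sin θ, cos θ)`. Its
product with `f(r) cos (m θ)` thus has separated variables, with radial primitive supplied by
`mul_eq`. -/
lemma isWeakGradient (h : IsRadialProfile m s f g) :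
    IsWeakGradient (modeFunction m f) (modeGradient m f g) := by
  intro φ hφ hφ' i
  have hA' : ∀ ρ : ℝ, 0 < ρ → IntervalIntegrable (fun x => f x + g x) volume 0 ρ :=
    fun ρ hρ => (h.intervalIntegrable_left hρ).add (h.intervalIntegrable_right hρ)
  have hB : ∀ ρ : ℝ, 0 < ρ → IntervalIntegrable f volume 0 ρ :=
    fun ρ hρ => h.intervalIntegrable_left hρ
  have hcm : ∀ θ : ℝ, HasDerivAt (fun θ : ℝ => Real.cos (m * θ)) (-Real.sin (m * θ) * m) θ :=
    fun θ => by simpa using ((hasDerivAt_id θ).const_mul (m : ℝ)).cos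
  rw [integral_polar, integral_polar]
  fin_cases i
  · have key := integral_polar_divergence (A := fun r => r * f r) hA' h.mul_eq hB
      (α := fun θ => Real.cos (m * θ) * Real.cos θ) (by fun_prop)
      (β := fun θ => -(Real.cos (m * θ) * Real.sin θ))
      (fun θ => ((hcm θ).mul (Real.hasDerivAt_sin θ)).neg) (by fun_prop) (by simp) hφ hφ'
    convert! key using 1
    · refine setIntegral_congr_fun measurableSet_polarDomain fun p hp => ?_
      have h0 : 0 < p.1 := hp.1
      have e := gradient_apply_zero_eq (φ := φ) p.1 p.2
      simp only [modeFunction, norm_polarPoint h0.le, polarAngle_polarPoint hp, Fin.zero_eta]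
      linear_combination f p.1 * Real.cos (m * p.2) * e
    · congr 1
      refine setIntegral_congr_fun measurableSet_polarDomain fun p hp => ?_
      have h0 : 0 < p.1 := hp.1
      simp only [modeGradient, norm_polarPoint h0.le, polarAngle_polarPoint hp, Fin.zero_eta,
        Matrix.cons_val_zero]
      field_simp
      ring
  · have key := integral_polar_divergence (A := fun r => r * f r) hA' h.mul_eq hB
      (α := fun θ => Real.cos (m * θ) * Real.sin θ) (by fun_prop)
      (β := fun θ => Real.cos (m * θ) * Real.cos θ)
      (fun θ => (hcm θ).mul (Real.hasDerivAt_cos θ)) (by fun_prop) (by simp) hφ hφ'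
    convert! key using 1
    · refine setIntegral_congr_fun measurableSet_polarDomain fun p hp => ?_
      have h0 : 0 < p.1 := hp.1
      have e := gradient_apply_one_eq (φ := φ) p.1 p.2
      simp only [modeFunction, norm_polarPoint h0.le, polarAngle_polarPoint hp, Fin.mk_one]
      linear_combination f p.1 * Real.cos (m * p.2) * e
    · congr 1
      refine setIntegral_congr_fun measurableSet_polarDomain fun p hp => ?_
      have h0 : 0 < p.1 := hp.1
      simp only [modeGradient, norm_polarPoint h0.le, polarAngle_polarPoint hp, Fin.mk_one,
        Matrix.cons_val_one, Matrix.cons_val_zero]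
      field_simp
      ring

/-- The function built from a radial profile solves the conductivity equation. -/
lemma isConductivitySolution (h : IsRadialProfile m s f g) (hs : Measurable s) {c : ℝ}
    (hc : ∀ x, |s x| ≤ c) {σ : Plane → ℝ} (hσ : ∀ x, σ x = s ‖x‖) :
    IsConductivitySolution σ (modeFunction m f) := by
  refine ⟨h.isLocL2_modeFunction, modeGradient m f g, h.isLocL2_modeGradient, h.isWeakGradient,
    fun φ hφ hφ' => ?_⟩
  have hB : ∀ ρ : ℝ, 0 < ρ → IntervalIntegrable (fun x => m * s x * f x / x) volume 0 ρ :=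
    fun ρ hρ => h.intervalIntegrable_flux hs hc hρ
  have hA' : ∀ ρ : ℝ, 0 < ρ → IntervalIntegrable (fun x => m ^ 2 * s x * f x / x) volume 0 ρ :=
    fun ρ hρ => ((hB ρ hρ).const_mul m).congr fun x _ => by ring
  have hsm : ∀ θ : ℝ, HasDerivAt (fun θ : ℝ => Real.sin (m * θ)) (Real.cos (m * θ) * m) θ :=
    fun θ => by simpa using ((hasDerivAt_id θ).const_mul (m : ℝ)).sin
  -- The radial flux contributes `m² s f / r * cos (m θ)` to the divergence, by `flux_eq`, and the
  -- angular flux contributes its negative.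
  have key := integral_polar_divergence (A := fun r => s r * g r) hA' h.flux_eq hB
    (α := fun θ => Real.cos (m * θ)) (by fun_prop) (β := fun θ => -Real.sin (m * θ))
    (fun θ => (hsm θ).neg) (by fun_prop) (by simp [Real.sin_nat_mul_pi]) hφ hφ'
  rw [integral_polar]
  refine Eq.trans ?_ (key.trans ?_)
  · refine setIntegral_congr_fun measurableSet_polarDomain fun p hp => ?_
    have h0 : 0 < p.1 := hp.1
    have hn : ‖polarPoint p‖ = p.1 := norm_polarPoint h0.le p.2
    simp only [inner_plane, modeGradient, hσ, hn, polarAngle_polarPoint hp, Matrix.cons_val_zero,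
      Matrix.cons_val_one, radialDeriv, angularDeriv]
    field_simp
    ring
  · rw [neg_eq_zero]
    refine integral_eq_zero_of_ae (Eventually.of_forall fun p => ?_)
    simp only [Pi.zero_apply]
    ring

end IsRadialProfile

/-- For `m = 0` the remainder `b / r ^ m` does not decay, hence the condition on `b`; otherwise `r ≤
r ^ m` for `r > 1`. -/
lemma vanishesAtInfinity_modeFunction_sub {m : ℕ} {f : ℝ → ℝ} {R b : ℝ}
    (hb : m = 0 → b = 0) (hf : ∀ r, R < r → f r = r ^ m + b / r ^ m) :
    VanishesAtInfinity
      (fun x => modeFunction m f x - ‖x‖ ^ m * Real.cos (m * polarAngle x)) := by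
  intro ε hε
  refine ⟨max R (max 1 (|b| / ε)), Eventually.of_forall fun x hx => ?_⟩
  obtain ⟨h1, h2⟩ := max_lt_iff.1 hx
  obtain ⟨h2, h3⟩ := max_lt_iff.1 h2
  have h0 : 0 < ‖x‖ := by linarith
  beta_reduce
  rw [modeFunction, hf _ h1, ← sub_mul, add_sub_cancel_left, abs_mul]
  refine (mul_le_of_le_one_right (abs_nonneg _) (Real.abs_cos_le_one _)).trans_lt ?_
  rcases Nat.eq_zero_or_pos m with hm | hm
  · simpa [hb hm] using hε
  · rw [abs_div, abs_of_pos (pow_pos h0 m), div_lt_iff₀ (pow_pos h0 m)]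
    rw [div_lt_iff₀ hε] at h3
    have := le_self_pow₀ h2.le hm.ne'
    nlinarith

/-! ### Radial supports -/

/-- The continuous map `z ↦ (‖z‖ / ‖y‖) • y` preserves norms, hence the support and its closure, and
it sends `x` to `y`. -/
lemma IsRadiallySymmetric.mem_tsupport {σ : Plane → ℝ} (hσ : IsRadiallySymmetric σ) {x y : Plane}
    (hx : x ∈ tsupport (fun x => σ x - 1)) (hxy : ‖y‖ = ‖x‖) :
    y ∈ tsupport (fun x => σ x - 1) := by
  rcases eq_or_ne y 0 with rfl | hy
  · rw [norm_zero, eq_comm, norm_eq_zero] at hxy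
    rwa [← hxy]
  have hy0 : 0 < ‖y‖ := norm_pos_iff.2 hy
  have hcont : Continuous fun z : Plane => (‖z‖ / ‖y‖) • y := by fun_prop
  have hmaps : Set.MapsTo (fun z : Plane => (‖z‖ / ‖y‖) • y)
      (Function.support fun x => σ x - 1) (Function.support fun x => σ x - 1) := by
    intro z hz
    have : ‖(‖z‖ / ‖y‖) • y‖ = ‖z‖ := by
      rw [norm_smul, Real.norm_of_nonneg (by positivity), div_mul_cancel₀ _ hy0.ne']
    simpa [hσ _ _ this] using hz
  have h := hmaps.closure hcont hx
  beta_reduce at h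
  rwa [← hxy, div_self hy0.ne', one_smul] at h

/-- Outside a domain with connected complement which contains the support of `σ - 1`, the radial
conductivity `σ` is `1` in a neighbourhood of infinity. -/
lemma IsRadiallySymmetric.exists_radius {σ : Plane → ℝ} (hσ : IsRadiallySymmetric σ)
    {D : Set Plane} (hD_bdd : Bornology.IsBounded D) (hD_compl : IsConnected Dᶜ)
    (hσ_supp : tsupport (fun x => σ x - 1) ⊆ D) :
    ∃ R : ℝ, 0 ≤ R ∧ (∀ x, R < ‖x‖ → σ x = 1) ∧ ∀ x, x ∉ D → x ≠ 0 → R < ‖x‖ := by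
  set S := tsupport (fun x => σ x - 1) with hS
  rcases S.eq_empty_or_nonempty with hemp | hne
  -- With empty support the radius is `0`, and the origin may lie outside `D`; this is why the
  -- conclusion excludes it.
  · refine ⟨0, le_rfl, fun x _ => ?_, fun x _ hx => norm_pos_iff.2 hx⟩
    have : x ∉ S := by simp [hemp]
    linarith [image_eq_zero_of_notMem_tsupport this]
  have hSc : IsCompact S :=
    Metric.isCompact_of_isClosed_isBounded (isClosed_tsupport _) (hD_bdd.subset hσ_supp)
  obtain ⟨x₀, hx₀, hmax⟩ := hSc.exists_isMaxOn hne continuous_norm.continuousOn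
  refine ⟨‖x₀‖, norm_nonneg _, fun x hx => ?_, fun x hx _ => ?_⟩
  · have : x ∉ S := fun h => not_le.2 hx (hmax h)
    linarith [image_eq_zero_of_notMem_tsupport this]
  · have hsphere : ∀ y : Plane, ‖y‖ = ‖x₀‖ → y ∈ D := fun y hy => hσ_supp (hσ.mem_tsupport hx₀ hy)
    by_contra hle
    obtain ⟨B, hB⟩ := hD_bdd.subset_closedBall (0 : Plane)
    obtain ⟨z, hz⟩ := NormedSpace.exists_lt_norm ℝ Plane (max B ‖x₀‖)
    have hzD : z ∈ Dᶜ := fun h => by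
      have := hB h
      rw [mem_closedBall_zero_iff] at this
      exact absurd ((le_max_left _ _).trans_lt hz) (not_lt.2 this)
    -- The norm takes an interval of values on the complement, from `‖x‖ ≤ ‖x₀‖` to `‖z‖ > ‖x₀‖`. It
    -- would attain `‖x₀‖`, but that circle lies in `D`.
    have himg : IsPreconnected (norm '' Dᶜ) :=
      hD_compl.isPreconnected.image _ continuous_norm.continuousOn
    obtain ⟨y, hy, hyn⟩ := himg.Icc_subset ⟨x, hx, rfl⟩ ⟨z, hzD, rfl⟩
      ⟨not_lt.1 hle, ((le_max_right _ _).trans_lt hz).le⟩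
    exact hy (hsphere y hyn)

theorem lemma3p3 (σ : Plane → ℝ) (hσ_meas : Measurable σ) (c : ℝ) (hc : 1 < c)
    (hσ_bounds : ∀ x, c⁻¹ ≤ σ x ∧ σ x ≤ c) (hσ_radial : IsRadiallySymmetric σ)
    (D : Set Plane) (hD_open : IsOpen D) (hD_conn : IsConnected D)
    (hD_bdd : Bornology.IsBounded D) (hD_compl : IsConnected Dᶜ)
    (hσ_supp : tsupport (fun x => σ x - 1) ⊆ D) (m : ℕ) :
    ∃ u : Plane → ℝ, IsModeSolution σ m u ∧
      (∀ v : Plane → ℝ, IsModeSolution σ m v → v =ᵐ[volume] u) ∧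
      ∃ b : ℝ, ∀ᵐ x : Plane, x ∉ D →
        u x = (‖x‖ ^ m + b / ‖x‖ ^ m) * Real.cos (m * polarAngle x) := by
  obtain ⟨R, hR0, hR1, hRD⟩ := hσ_radial.exists_radius hD_bdd hD_compl hσ_supp
  set s : ℝ → ℝ := fun r => σ (polarPoint (r, 0)) with hs
  have hs_meas : Measurable s :=
    hσ_meas.comp (continuous_polarPoint.measurable.comp (measurable_id.prodMk measurable_const))
  have hσs : ∀ x, σ x = s ‖x‖ := fun x =>
    hσ_radial _ _ (norm_polarPoint (norm_nonneg x) 0).symm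
  have hs1 : ∀ r, R < r → s r = 1 := fun r hr =>
    hR1 _ (by rwa [norm_polarPoint (hR0.trans hr.le)])
  have habs : ∀ x, |σ x| ≤ c := fun x => by
    rw [abs_of_pos ((inv_pos.2 (by linarith)).trans_le (hσ_bounds x).1)]
    exact (hσ_bounds x).2
  obtain ⟨f, g, hprof, b, hb, hf⟩ := exists_isRadialProfile m hc hs_meas
    (fun r => hσ_bounds _) hR0 hs1
  have hsol : IsModeSolution σ m (modeFunction m f) :=
    ⟨hprof.isConductivitySolution hs_meas (fun r => habs _) hσs,
      vanishesAtInfinity_modeFunction_sub hb hf⟩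
  refine ⟨modeFunction m f, hsol, fun v hv => ?_, b, ?_⟩
  · have hdiff := hv.1.sub hσ_meas habs hsol.1
    have hvan : VanishesAtInfinity (fun x => v x - modeFunction m f x) := by
      simpa using hv.2.sub hsol.2
    filter_upwards [hdiff.ae_eq_zero hσ_meas hc hσ_bounds hvan] with x hx
    exact sub_eq_zero.1 hx
  · filter_upwards [Measure.ae_ne volume (0 : Plane)] with x hx0 hxD
    rw [modeFunction, hf _ (hRD x hxD hx0)]
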